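/- Let $R$ be a commutative Noetherian ring, let $\mathfrak b \subseteq \mathfrak a$ be ideals of $R$, and let $M$ be a finitely generated $R$-module. Then $$\mu^{\mathfrak b R_{\mathfrak p}}_{\mathfrak a R_{\mathfrak p}}(M_{\mathfrak p}) > 2 \ \text{ for all } \mathfrak p \in \operatorname{Spec} R \iff \mu^{\mathfrak b}_{\mathfrak a}(M) > 2 .$$ Here, for ideals $\mathfrak b\subseteq\mathfrak a$ of a commutative Noetherian ring $S$ and a finitely generated $S$-module $N$, the $\mathfrak b$-minimaxness dimension of $N$ relative to $\mathfrak a$ is $$\mu^{\mathfrak b}_{\mathfrak a}(N) := \inf\{\, i \ge 1 : \mathfrak b^t H^i_{\mathfrak a}(N) \text{ is not minimax for all integers } t \ge 1 \,\} \in \mathbb{N} \cup \{\infty\},$$ with $\inf \emptyset = \infty$, where $H^i_{\mathfrak a}(N) = \varinjlim_{n\ge 1} \operatorname{Ext}^i_S(S/\mathfrak a^n, N)$ is the $i$-th local cohomology module, and an $S$-module $L$ is called minimax if it has a finitely generated submodule $L'$ such that $L/L'$ is Artinian. -/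

import Mathlib

universe u

/-- A module `L` is minimax if it has a finitely generated submodule `N` such that `L / N` is
Artinian. -/
def IsMinimaxModule (R : Type*) [CommRing R] (L : Type*) [AddCommGroup L] [Module R L] : Prop :=
  ∃ N : Submodule R L, N.FG ∧ IsArtinian R (L ⧸ N)

/-- The `i`-th local cohomology module `H^i_a(M)`, the direct limit over `n` of the modules
`Ext^i_R(R / a ^ n, M)`. -/
noncomputable abbrev LocalCohomologyModule {R : Type u} [CommRing R] (a : Ideal R) (i : ℕ)
    (M : Type u) [AddCommGroup M] [Module R M] : ModuleCat.{u} R :=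
  (localCohomology a i).obj (ModuleCat.of R M)

/-- The `b`-minimaxness dimension `μ_a^b(M)` of `M` relative to `a`: the infimum of all positive
integers `i` such that `b ^ t H^i_a(M)` is not minimax for all positive integers `t`.
The infimum of the empty set is `⊤`. -/
noncomputable def minimaxnessDim {R : Type u} [CommRing R] (b a : Ideal R)
    (M : Type u) [AddCommGroup M] [Module R M] : ℕ∞ :=
  sInf {n : ℕ∞ | ∃ i : ℕ, 0 < i ∧ n = i ∧
    ∀ t : ℕ, 0 < t → ¬ IsMinimaxModule R
      (b ^ t • (⊤ : Submodule R (LocalCohomologyModule a i M)) :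
        Submodule R (LocalCohomologyModule a i M))}

/-!
Write `H^i(M)` for the local cohomology of `M` with respect to `a`. Since `H^i(M)` is
`a`-power-torsion and `b ≤ a`, some `b ^ t • H^i(M)` is minimax if and only if some
`b ^ t • H^i(M)` is Artinian (`exists_isMinimaxModule_iff`). Thus the dimension exceeds `2`
exactly when `H^1(M)` and `H^2(M)` are eventually Artinian in this sense, and this property
localizes as soon as `H^1` and `H^2` are known to commute with localization.

For the converse the tool is `VanishesAwayFromMax.isEventuallyArtinian`: an `a`-power-torsion
module `T` with `(0 :_T a)` minimax is eventually Artinian if at every nonmaximal prime `q` some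
`b ^ t • T` vanishes. The minimax module `(0 :_T a)` has only finitely many nonmaximal associated
primes, which makes the exponent uniform, and Melkersson's criterion then yields the Artinian
property. The vanishing at `q` follows from the hypothesis at a maximal ideal above `q`, since
over a local ring the elements of an Artinian module are killed by powers of the maximal ideal.

It remains to see that `(0 :_T a)` is minimax for `T = H^1` and `T = H^2`. Replacing `M` by
`N = M ⧸ Γ_b(M)` changes nothing (`ExtColimit.isEventuallyArtinian_iff`), and then some `y ∈ b` is
regular on `N`. Put `J = N_y` and `C = J ⧸ N`; the local cohomology of `J` vanishes.
* In degree one, `(0 :_T a)` is a quotient of `Ext^1(R ⧸ a, N)`, because `N` has no `a`-torsion.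
* `H^1(N)` is isomorphic to `Γ_a(C)`; if `b ^ t • H^1(N)` is Artinian, then `Γ_a(C)` is minimax,
  because `(0 :_C y ^ t)` is a quotient of `N` (`isMinimaxModule_idealPowTorsion`).
* `H^2(N)` is `H^1(C)`, which embeds in `H^1(C ⧸ Γ_a(C))`. There, the elements killed by `a` come
  from `Ext^1(R ⧸ a, C ⧸ Γ_a(C))`, which is minimax because `Ext^1(R ⧸ a, C)` embeds in
  `Ext^2(R ⧸ a, N)` and `Γ_a(C)` is minimax (`isMinimaxModule_torsionBySet_two`).

The identity `H^2(N) = H^1(C)` is also what makes localization elementary: a first local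
cohomology module is the direct limit of `Hom(a ^ n, -)` modulo the homomorphisms that extend to
the whole ring (`HomColimit`), and such limits commute with localization.
-/

/-! ### Cocycles of a projective resolution and the derived functor `Ext` -/

section
open CategoryTheory CategoryTheory.Limits Opposite

section
variable {R : Type u} [CommRing R] {X Y : ModuleCat.{u} R}

/-- The degree `n` cocycles of the complex `Hom(P, Y)`, for a projective resolution `P` of `X`. -/
abbrev cocycleModule (P : ProjectiveResolution X) (Y : ModuleCat.{u} R) (n : ℕ) :
    Submodule R (P.complex.X n ⟶ Y) :=
  LinearMap.ker (Linear.leftComp R Y (P.complex.d (n + 1) n))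

/-- The complex `Hom(P, Y)`, regarded as a chain complex in the opposite category; the functor
`Ext` of `Mathlib`, a left derived functor into the opposite category, is computed by its
homology. -/
noncomputable abbrev homComplexOp (P : ProjectiveResolution X) (Y : ModuleCat.{u} R) :
    ChainComplex (ModuleCat.{u} R)ᵒᵖ ℕ :=
  (((linearYoneda R (ModuleCat.{u} R)).obj Y).rightOp.mapHomologicalComplex _).obj P.complex

variable (K : ChainComplex (ModuleCat.{u} R)ᵒᵖ ℕ)

lemma exists_pOpcycles_unop_eq (n : ℕ) (f : (K.X n).unop) (hf : (K.d (n + 1) n).unop.hom f = 0) :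
    ∃ z : (K.opcycles n).unop, (K.pOpcycles n).unop.hom z = f := by
  have h : (ShortComplex.mk (K.d (n + 1) n) (K.pOpcycles n) (by simp)).Exact :=
    ShortComplex.exact_of_g_is_cokernel _ (K.opcyclesIsCokernel (n + 1) n (by simp))
  have h2 := h.unop
  rw [ShortComplex.moduleCat_exact_iff] at h2
  exact h2 f hf

lemma pOpcycles_unop_injective (n : ℕ) : Function.Injective (K.pOpcycles n).unop.hom := by
  have : Mono (K.pOpcycles n).unop := inferInstance
  exact (ModuleCat.mono_iff_injective _).1 this

lemma homologyι_unop_surjective (n : ℕ) : Function.Surjective (K.homologyι n).unop.hom := by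
  have : Epi (K.homologyι n).unop := inferInstance
  exact (ModuleCat.epi_iff_surjective _).1 this

/-- Opcycles in the opposite category are cocycles, and such a cocycle is zero in homology exactly
when it is a coboundary. -/
lemma homologyι_unop_eq_zero_iff (n : ℕ) (z : (K.opcycles (n + 1)).unop) :
    (K.homologyι (n + 1)).unop.hom z = 0 ↔
      ∃ g : (K.X n).unop, (K.d (n + 1) n).unop.hom g = (K.pOpcycles (n + 1)).unop.hom z := by
  have h : (ShortComplex.mk (K.homologyι (n + 1)) (K.fromOpcycles (n + 1) n) (by simp)).Exact :=
    ShortComplex.exact_of_f_is_kernel _ (K.homologyIsKernel (n + 1) n (by simp))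
  have h2 := h.unop
  rw [ShortComplex.moduleCat_exact_iff] at h2
  have key : ∀ g : (K.X n).unop, (K.pOpcycles (n + 1)).unop.hom
      ((K.fromOpcycles (n + 1) n).unop.hom g) = (K.d (n + 1) n).unop.hom g := by
    intro g
    rw [← LinearMap.comp_apply, ← ModuleCat.hom_comp, ← unop_comp, K.p_fromOpcycles]
  constructor
  · intro hz
    obtain ⟨g, hg⟩ := h2 z hz
    exact ⟨g, (key g).symm.trans (congrArg _ hg)⟩
  · rintro ⟨g, hg⟩
    rw [← key] at hg
    rw [← pOpcycles_unop_injective K _ hg]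
    rw [← LinearMap.comp_apply, ← ModuleCat.hom_comp, ← unop_comp, K.homologyι_comp_fromOpcycles]
    rfl

/-- The opposite of the opcycles of `Hom(P, Y)` are its cocycles. -/
noncomputable def opcyclesEquivCocycles (P : ProjectiveResolution X) (Y : ModuleCat.{u} R) (n : ℕ) :
    ((homComplexOp P Y).opcycles n).unop ≃ₗ[R] cocycleModule P Y n :=
  LinearEquiv.ofBijective
    (LinearMap.codRestrict (cocycleModule P Y n) ((homComplexOp P Y).pOpcycles n).unop.hom
      (fun z => by
        have h : (homComplexOp P Y).d (n + 1) n ≫ (homComplexOp P Y).pOpcycles n = 0 :=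
          HomologicalComplex.d_pOpcycles _ _ _
        have h2 := congrArg (fun f => f.unop.hom z) h
        exact h2))
    ⟨fun z z' h => pOpcycles_unop_injective _ n (congrArg Subtype.val h), fun f => by
      obtain ⟨z, hz⟩ := exists_pOpcycles_unop_eq (homComplexOp P Y) n f.1 f.2
      exact ⟨z, Subtype.ext hz⟩⟩

/-- The class of a cocycle in the module `Ext` defined as a derived functor. -/
noncomputable def cocycleToExt (P : ProjectiveResolution X) (Y : ModuleCat.{u} R) (n : ℕ) :
    cocycleModule P Y n →ₗ[R] ((Ext R (ModuleCat.{u} R) n).obj (op X)).obj Y :=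
  (P.isoLeftDerivedObj ((linearYoneda R (ModuleCat.{u} R)).obj Y).rightOp n).hom.unop.hom ∘ₗ
    ((homComplexOp P Y).homologyι n).unop.hom ∘ₗ (opcyclesEquivCocycles P Y n).symm.toLinearMap

lemma cocycleToExt_apply (P : ProjectiveResolution X) (Y : ModuleCat.{u} R) (n : ℕ)
    (z : ((homComplexOp P Y).opcycles n).unop) :
    cocycleToExt P Y n (opcyclesEquivCocycles P Y n z) =
      (P.isoLeftDerivedObj ((linearYoneda R (ModuleCat.{u} R)).obj Y).rightOp n).hom.unop.hom
        (((homComplexOp P Y).homologyι n).unop.hom z) :=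
  congrArg (fun z => (P.isoLeftDerivedObj
    ((linearYoneda R (ModuleCat.{u} R)).obj Y).rightOp n).hom.unop.hom
      (((homComplexOp P Y).homologyι n).unop.hom z))
    ((opcyclesEquivCocycles P Y n).symm_apply_apply z)

lemma cocycleToExt_surjective (P : ProjectiveResolution X) (Y : ModuleCat.{u} R) (n : ℕ) :
    Function.Surjective (cocycleToExt P Y n) := by
  have h1 : Function.Surjective (P.isoLeftDerivedObj
      ((linearYoneda R (ModuleCat.{u} R)).obj Y).rightOp n).hom.unop.hom := by
    have : Epi (P.isoLeftDerivedObj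
      ((linearYoneda R (ModuleCat.{u} R)).obj Y).rightOp n).hom.unop := inferInstance
    exact (ModuleCat.epi_iff_surjective _).1 this
  exact h1.comp ((homologyι_unop_surjective _ n).comp (opcyclesEquivCocycles P Y n).symm.surjective)

lemma cocycleToExt_eq_zero_iff (P : ProjectiveResolution X) (Y : ModuleCat.{u} R) (n : ℕ)
    (f : cocycleModule P Y (n + 1)) :
    cocycleToExt P Y (n + 1) f = 0 ↔
      ∃ g : P.complex.X n ⟶ Y, P.complex.d (n + 1) n ≫ g = f.1 := by
  have h1 : Function.Injective (P.isoLeftDerivedObj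
      ((linearYoneda R (ModuleCat.{u} R)).obj Y).rightOp (n + 1)).hom.unop.hom := by
    have : Mono (P.isoLeftDerivedObj
      ((linearYoneda R (ModuleCat.{u} R)).obj Y).rightOp (n + 1)).hom.unop := inferInstance
    exact (ModuleCat.mono_iff_injective _).1 this
  obtain ⟨z, rfl⟩ := (opcyclesEquivCocycles P Y (n + 1)).surjective f
  rw [cocycleToExt_apply]
  exact (map_eq_zero_iff _ h1).trans (homologyι_unop_eq_zero_iff (homComplexOp P Y) n z)

lemma cocycleToExt_map {X' : ModuleCat.{u} R} (g : X' ⟶ X) (P : ProjectiveResolution X)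
    (P' : ProjectiveResolution X') (φ : ProjectiveResolution.Hom P' P g)
    (Y : ModuleCat.{u} R) (n : ℕ) (f : cocycleModule P Y n) (f' : cocycleModule P' Y n)
    (h : f'.1 = φ.hom.f n ≫ f.1) :
    (((Ext R (ModuleCat.{u} R) n).map g.op).app Y).hom (cocycleToExt P Y n f) =
      cocycleToExt P' Y n f' := by
  obtain ⟨z, rfl⟩ := (opcyclesEquivCocycles P Y n).surjective f
  set G := ((linearYoneda R (ModuleCat.{u} R)).obj Y).rightOp
  have e1 := ProjectiveResolution.isoLeftDerivedObj_hom_naturality g P' P φ.hom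
    φ.hom_f_zero_comp_π_f_zero G n
  have e2 := HomologicalComplex.homologyι_naturality ((G.mapHomologicalComplex _).map φ.hom) n
  have e3 := HomologicalComplex.p_opcyclesMap ((G.mapHomologicalComplex _).map φ.hom) n
  let z' : ((homComplexOp P' Y).opcycles n).unop :=
    (HomologicalComplex.opcyclesMap ((G.mapHomologicalComplex _).map φ.hom) n).unop.hom z
  have hz' : f' = opcyclesEquivCocycles P' Y n z' := by
    refine Subtype.ext (h.trans ?_)
    exact (congrArg (fun k => k.unop.hom z) e3).symm
  rw [hz']
  rw [cocycleToExt_apply, cocycleToExt_apply]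
  have e4 := congrArg (fun k => k.unop.hom (((homComplexOp P Y).homologyι n).unop.hom z)) e1
  refine e4.trans ?_
  have e5 := congrArg (fun k => k.unop.hom z) e2
  exact congrArg (P'.isoLeftDerivedObj G n).hom.unop.hom e5
end
end

/-! ### Local cohomology as a direct limit of `Abelian.Ext` -/

section
open CategoryTheory CategoryTheory.Limits Opposite

/-- A linear map out of a directed colimit, in elementary form: `T` is the directed union of the
images of the maps `p i : E i → T`, and the maps `f i : E i → T'` descend to `T` as soon as each
`f i` kills the kernel of `p i`. -/
lemma exists_linearMap_of_directed {R ι T T' : Type*} [CommRing R] [AddCommGroup T] [Module R T]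
    [AddCommGroup T'] [Module R T'] {E : ι → Type*} [∀ i, AddCommGroup (E i)]
    [∀ i, Module R (E i)] (p : ∀ i, E i →ₗ[R] T) (f : ∀ i, E i →ₗ[R] T')
    (surj : ∀ t, ∃ i e, p i e = t)
    (dir : ∀ i j, ∃ k, ∃ (a : E i →ₗ[R] E k) (b : E j →ₗ[R] E k),
      (∀ e, p k (a e) = p i e) ∧ (∀ e, p k (b e) = p j e) ∧
      (∀ e, f k (a e) = f i e) ∧ (∀ e, f k (b e) = f j e))
    (ker : ∀ i e, p i e = 0 → f i e = 0) :
    ∃ g : T →ₗ[R] T', ∀ i e, g (p i e) = f i e := by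
  have key : ∀ i j e e', p i e = p j e' → f i e = f j e' := by
    intro i j e e' h
    obtain ⟨k, a, b, h1, h2, h3, h4⟩ := dir i j
    have := ker k (a e - b e') (by rw [map_sub, h1, h2, h, sub_self])
    rw [map_sub, h3, h4] at this
    exact sub_eq_zero.1 this
  choose idx rep hrep using surj
  refine ⟨{ toFun := fun t => f (idx t) (rep t), map_add' := ?_, map_smul' := ?_ }, ?_⟩
  · intro t t'
    obtain ⟨k, a, b, h1, h2, h3, h4⟩ := dir (idx t) (idx t')
    rw [← h3, ← h4, ← map_add]
    apply key
    rw [hrep, map_add, h1, h2, hrep, hrep]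
  · intro r t
    rw [RingHom.id_apply, ← map_smul]
    apply key
    rw [hrep, map_smul, hrep]
  · intro i e
    exact key _ _ _ _ (hrep _)

section
variable {R : Type u} [CommRing R] {X Y : ModuleCat.{u} R}

/-- The class of a cocycle in `Abelian.Ext`, the `Ext` with long exact sequences. -/
noncomputable def cocycleToAbelianExt (P : ProjectiveResolution X) (Y : ModuleCat.{u} R) (n : ℕ) :
    cocycleModule P Y n →ₗ[R] Abelian.Ext X Y n where
  toFun f := P.extMk f.1 (n + 1) rfl f.2
  map_add' f g := (P.add_extMk f.1 g.1 (n + 1) rfl f.2 g.2).symm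
  map_smul' r f := by
    rw [RingHom.id_apply, Abelian.Ext.smul_eq_comp_mk₀]
    refine Eq.trans ?_ (P.extMk_comp_mk₀ f.1 _ rfl f.2 _).symm
    congr 1

/-- Both versions of `Ext` are quotients of the module of cocycles, by the same submodule. -/
lemma exists_extEquiv (P : ProjectiveResolution X) (Y : ModuleCat.{u} R) (n : ℕ) :
    ∃ Φ : Abelian.Ext X Y (n + 1) ≃ₗ[R] ((Ext R (ModuleCat.{u} R) (n + 1)).obj (op X)).obj Y,
      ∀ f, Φ (cocycleToAbelianExt P Y (n + 1) f) = cocycleToExt P Y (n + 1) f := by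
  have s1 : ∀ t, ∃ (_ : Unit) (e : cocycleModule P Y (n + 1)),
      cocycleToAbelianExt P Y (n + 1) e = t := fun t => by
    obtain ⟨f, hf, rfl⟩ := P.extMk_surjective t (n + 1 + 1) rfl
    exact ⟨(), ⟨f, hf⟩, rfl⟩
  have k : ∀ e, cocycleToAbelianExt P Y (n + 1) e = 0 ↔ cocycleToExt P Y (n + 1) e = 0 := fun e =>
    (P.extMk_eq_zero_iff e.1 (n + 1 + 1) rfl e.2 n rfl).trans
      (cocycleToExt_eq_zero_iff P Y n e).symm
  obtain ⟨g, hg⟩ := exists_linearMap_of_directed (ι := Unit)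
    (fun _ => cocycleToAbelianExt P Y (n + 1)) (fun _ => cocycleToExt P Y (n + 1)) s1
    (fun _ _ => ⟨(), LinearMap.id, LinearMap.id, by simp⟩) (fun _ e => (k e).1)
  refine ⟨LinearEquiv.ofBijective g ⟨?_, ?_⟩, fun f => hg () f⟩
  · rw [injective_iff_map_eq_zero]
    intro t ht
    obtain ⟨_, e, rfl⟩ := s1 t
    rw [hg ()] at ht
    exact (k e).2 ht
  · intro t
    obtain ⟨e, rfl⟩ := cocycleToExt_surjective P Y (n + 1) t
    exact ⟨_, hg () e⟩

/-- The comparison isomorphism, in positive degrees, between `Abelian.Ext` and the derived functor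
`Ext` through which local cohomology is defined. -/
noncomputable def extEquiv (X Y : ModuleCat.{u} R) (n : ℕ) :
    Abelian.Ext X Y (n + 1) ≃ₗ[R] ((Ext R (ModuleCat.{u} R) (n + 1)).obj (op X)).obj Y :=
  (exists_extEquiv (projectiveResolution X) Y n).choose

lemma extEquiv_naturality {X' : ModuleCat.{u} R} (g : X' ⟶ X) (n : ℕ)
    (e : Abelian.Ext X Y (n + 1)) :
    (((Ext R (ModuleCat.{u} R) (n + 1)).map g.op).app Y).hom (extEquiv X Y n e) =
      extEquiv X' Y n ((Abelian.Ext.mk₀ g).comp e (zero_add _)) := by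
  obtain ⟨f, hf, rfl⟩ := (projectiveResolution X).extMk_surjective e (n + 1 + 1) rfl
  let φ : ProjectiveResolution.Hom (projectiveResolution X') (projectiveResolution X) g :=
    ⟨ProjectiveResolution.lift g _ _, ProjectiveResolution.lift_commutes_zero g _ _⟩
  rw [ProjectiveResolution.mk₀_comp_extMk _ _ _ _ φ]
  have h1 := (exists_extEquiv (projectiveResolution X) Y n).choose_spec ⟨f, hf⟩
  have hf' : (projectiveResolution X').complex.d (n + 1 + 1) (n + 1) ≫ φ.hom.f (n + 1) ≫ f = 0 := by
    rw [← φ.hom.comm_assoc, hf, comp_zero]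
  have h2 := (exists_extEquiv (projectiveResolution X') Y n).choose_spec ⟨_, hf'⟩
  refine (congrArg _ h1).trans (Eq.trans ?_ h2.symm)
  exact cocycleToExt_map g _ _ φ Y (n + 1) _ _ rfl

/-- The projection `R ⧸ a ^ m → R ⧸ a ^ n` for `n ≤ m`. -/
def quotPowMap (a : Ideal R) {n m : ℕ} (h : n ≤ m) :
    ModuleCat.of R (R ⧸ a ^ m) ⟶ ModuleCat.of R (R ⧸ a ^ n) :=
  ModuleCat.ofHom (Submodule.mapQ _ _ LinearMap.id (Ideal.pow_le_pow_right h))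

/-- A presentation of `T` as the direct limit over `n` of the modules `Ext^i(R ⧸ a ^ n, M)`: maps
`of n` that are compatible with the transition maps, jointly surjective, and such that an element
with zero image already dies at a finite stage. The limit property is stated on elements, so that
it can be transported along dimension shifts. -/
structure ExtColimit (a : Ideal R) (M : ModuleCat.{u} R) (i : ℕ) (T : Type u) [AddCommGroup T]
    [Module R T] where
  of : ∀ n : ℕ, Abelian.Ext (ModuleCat.of R (R ⧸ a ^ n)) M i →ₗ[R] T
  of_comp : ∀ {n m : ℕ} (h : n ≤ m) (e : Abelian.Ext (ModuleCat.of R (R ⧸ a ^ n)) M i),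
    of m ((Abelian.Ext.mk₀ (quotPowMap a h)).comp e (zero_add _)) = of n e
  exists_of : ∀ t, ∃ n e, of n e = t
  exists_eq_zero : ∀ n e, of n e = 0 →
    ∃ m, ∃ h : n ≤ m, (Abelian.Ext.mk₀ (quotPowMap a h)).comp e (zero_add _) = 0

lemma exists_rep_of_isColimit {J : Type} [SmallCategory J] [IsFiltered J]
    {F : J ⥤ ModuleCat.{u} R} {c : Cocone F} (hc : IsColimit c) (t : c.pt) :
    ∃ j x, (c.ι.app j).hom x = t := by
  have : PreservesFilteredColimitsOfSize.{0, 0} (forget (ModuleCat.{u} R)) :=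
    preservesFilteredColimitsOfSize_shrink.{0, u, 0, u} _
  exact Concrete.isColimit_exists_rep F hc t

lemma exists_map_eq_zero_of_isColimit {J : Type} [SmallCategory J] [IsFiltered J]
    {F : J ⥤ ModuleCat.{u} R} {c : Cocone F} (hc : IsColimit c) (j : J) (x : F.obj j)
    (hx : (c.ι.app j).hom x = 0) : ∃ k, ∃ f : j ⟶ k, (F.map f).hom x = 0 := by
  have : PreservesFilteredColimitsOfSize.{0, 0} (forget (ModuleCat.{u} R)) :=
    preservesFilteredColimitsOfSize_shrink.{0, u, 0, u} _
  obtain ⟨k, f, f', h⟩ := (Concrete.isColimit_rep_eq_iff_exists F hc x (0 : F.obj j)).1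
    (hx.trans (map_zero (c.ι.app j).hom).symm)
  exact ⟨k, f, h.trans (map_zero (F.map f').hom)⟩

/-- Local cohomology in a positive degree is the direct limit of the modules `Abelian.Ext`. -/
theorem nonempty_extColimit (a : Ideal R) (M : Type u) [AddCommGroup M] [Module R M] (i : ℕ) :
    Nonempty (ExtColimit a (ModuleCat.of R M) (i + 1) (LocalCohomologyModule a (i + 1) M)) := by
  let F := localCohomology.diagram (localCohomology.idealPowersDiagram a) (i + 1)
  let ev := (evaluation (ModuleCat.{u} R) (ModuleCat.{u} R)).obj (ModuleCat.of R M)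
  have := localCohomology.hasColimitDiagram.{u, 0} (localCohomology.idealPowersDiagram a) (i + 1)
  let c : Cocone (F ⋙ ev) := ev.mapCocone (colimit.cocone F)
  have hc : IsColimit c := isColimitOfPreserves ev (colimit.isColimit F)
  change Nonempty (ExtColimit a (ModuleCat.of R M) (i + 1) c.pt)
  clear_value c
  refine ⟨⟨fun n => (c.ι.app (op (op n))).hom ∘ₗ (extEquiv _ _ i).toLinearMap, ?_, ?_, ?_⟩⟩
  · intro n m h e
    have hw := c.w (Quiver.Hom.op (Quiver.Hom.op (homOfLE h)))
    have := congrArg (fun k => k.hom (extEquiv _ _ i e)) hw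
    refine Eq.trans ?_ this
    exact congrArg (c.ι.app (op (op m))).hom (extEquiv_naturality (quotPowMap a h) i e).symm
  · intro t
    obtain ⟨j, x, hx⟩ := exists_rep_of_isColimit hc t
    obtain ⟨e, he⟩ := (extEquiv _ _ i).surjective x
    exact ⟨j.unop.unop, e, (congrArg _ he).trans hx⟩
  · intro n e he
    obtain ⟨k, f, h⟩ := exists_map_eq_zero_of_isColimit hc (op (op n)) (extEquiv _ _ i e) he
    refine ⟨k.unop.unop, leOfHom f.unop.unop, ?_⟩
    apply (extEquiv _ _ i).injective
    rw [← extEquiv_naturality, map_zero]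
    exact h
end
end

/-! ### First local cohomology as a direct limit of `Hom`, and dimension shifting -/

section
open CategoryTheory CategoryTheory.Limits Opposite

/-- A presentation of `T` as the direct limit over `n` of the modules `Hom(a ^ n, N)` modulo the
homomorphisms `x ↦ x • c` with `c : N`. This limit is the first local cohomology module of `N`; its
elementary form makes sense over any base ring acting on `N`, which is what makes the comparison
with a localization possible. -/
structure HomColimit {R : Type*} [CommRing R] (a : Ideal R) (N : Type*) [AddCommGroup N]
    [Module R N] (T : Type*) [AddCommGroup T] [Module R T] where
  of : ∀ n : ℕ, (↥(a ^ n) →ₗ[R] N) →ₗ[R] T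
  of_restrict : ∀ {n m : ℕ} (h : n ≤ m) (φ : ↥(a ^ n) →ₗ[R] N),
    of m (φ ∘ₗ Submodule.inclusion (Ideal.pow_le_pow_right h)) = of n φ
  exists_of : ∀ t, ∃ n φ, of n φ = t
  of_eq_zero_iff : ∀ n φ, of n φ = 0 ↔ ∃ m, ∃ h : n ≤ m, ∃ c : N, ∀ x : ↥(a ^ m),
    φ (Submodule.inclusion (Ideal.pow_le_pow_right h) x) = (x : R) • c

section
variable {R : Type u} [CommRing R]

/-- The short complex `I → R → R ⧸ I`. -/
abbrev idealShortComplex (I : Ideal R) : ShortComplex (ModuleCat.{u} R) :=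
  ShortComplex.mk (ModuleCat.ofHom I.subtype) (ModuleCat.ofHom I.mkQ)
    (by ext x; exact (Submodule.Quotient.mk_eq_zero I).2 x.2)

lemma idealShortComplex_shortExact (I : Ideal R) : (idealShortComplex I).ShortExact where
  exact := by
    rw [ShortComplex.moduleCat_exact_iff]
    intro x hx
    exact ⟨⟨x, (Submodule.Quotient.mk_eq_zero I).1 hx⟩, rfl⟩
  mono_f := (ModuleCat.mono_iff_injective _).2 Subtype.val_injective
  epi_g := (ModuleCat.epi_iff_surjective _).2 (Submodule.mkQ_surjective I)

/-- The connecting map `Hom(I, N) → Ext^1(R ⧸ I, N)`. -/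
noncomputable def homToExt (I : Ideal R) (N : ModuleCat.{u} R) :
    (I →ₗ[R] N) →ₗ[R] Abelian.Ext (ModuleCat.of R (R ⧸ I)) N 1 where
  toFun φ := (idealShortComplex_shortExact I).extClass.comp
    (Abelian.Ext.mk₀ (X := ModuleCat.of R I) (ModuleCat.ofHom φ)) (add_zero 1)
  map_add' φ ψ := by
    rw [← Abelian.Ext.comp_add, ← Abelian.Ext.mk₀_add]; rfl
  map_smul' r φ := by
    rw [RingHom.id_apply, ← Abelian.Ext.comp_smul, ← Abelian.Ext.mk₀_smul]; rfl

lemma homToExt_surjective (I : Ideal R) (N : ModuleCat.{u} R) :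
    Function.Surjective (homToExt I N) := by
  intro e
  have : Projective (idealShortComplex I).X₂ := inferInstanceAs (Projective (ModuleCat.of R R))
  obtain ⟨f, hf⟩ := precomp_extClass_surjective_of_projective_X₂ N
    (idealShortComplex_shortExact I) 0 e
  obtain ⟨φ, rfl⟩ := (Abelian.Ext.mk₀_bijective _ _).2 f
  exact ⟨φ.hom, hf⟩

lemma homToExt_eq_zero_iff (I : Ideal R) (N : ModuleCat.{u} R) (φ : I →ₗ[R] N) :
    homToExt I N φ = 0 ↔ ∃ c : N, ∀ x : I, φ x = (x : R) • c := by
  constructor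
  · intro h
    obtain ⟨g, hg⟩ := Abelian.Ext.contravariant_sequence_exact₁ (idealShortComplex_shortExact I) N
      (Abelian.Ext.mk₀ (X := ModuleCat.of R I) (ModuleCat.ofHom φ)) (add_zero 1) h
    obtain ⟨ψ, rfl⟩ := (Abelian.Ext.mk₀_bijective _ _).2 g
    rw [Abelian.Ext.mk₀_comp_mk₀] at hg
    have h2 := (Abelian.Ext.mk₀_bijective _ _).1 hg
    refine ⟨ψ.hom (1 : R), fun x => ?_⟩
    have h3 : ψ.hom (x : R) = φ x := congrArg (fun k => k.hom x) h2
    rw [← h3]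
    exact (congrArg ψ.hom (mul_one (x : R)).symm).trans (map_smul ψ.hom (x : R) (1 : R))
  · rintro ⟨c, hc⟩
    have : φ = (LinearMap.toSpanSingleton R N c) ∘ₗ I.subtype := by
      ext x; simp [hc]
    subst this
    have := (idealShortComplex_shortExact I).extClass_comp_assoc
      (Abelian.Ext.mk₀ (X := ModuleCat.of R R)
        (ModuleCat.ofHom (LinearMap.toSpanSingleton R N c))) (h := add_zero 1)
    rw [Abelian.Ext.mk₀_comp_mk₀] at this
    exact this

lemma homToExt_restrict {I I' : Ideal R} (h : I' ≤ I) (N : ModuleCat.{u} R) (φ : I →ₗ[R] N) :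
    (Abelian.Ext.mk₀ (ModuleCat.ofHom (Submodule.mapQ I' I LinearMap.id h))).comp
      (homToExt I N φ) (zero_add 1) = homToExt I' N (φ ∘ₗ Submodule.inclusion h) := by
  let F : idealShortComplex I' ⟶ idealShortComplex I :=
    { τ₁ := ModuleCat.ofHom (Submodule.inclusion h)
      τ₂ := 𝟙 _
      τ₃ := ModuleCat.ofHom (Submodule.mapQ I' I LinearMap.id h)
      comm₁₂ := rfl
      comm₂₃ := rfl }
  have h1 := (idealShortComplex_shortExact I').extClass_naturality
    (idealShortComplex_shortExact I) F
  have h2 : (Abelian.Ext.mk₀ F.τ₃).comp (homToExt I N φ) (zero_add 1) =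
      ((Abelian.Ext.mk₀ F.τ₃).comp (idealShortComplex_shortExact I).extClass (zero_add 1)).comp
        (Abelian.Ext.mk₀ (X := ModuleCat.of R I) (ModuleCat.ofHom φ)) (add_zero 1) :=
    (Abelian.Ext.comp_assoc _ _ _ (zero_add 1) (add_zero 1) (by simp)).symm
  refine h2.trans ?_
  rw [← h1, Abelian.Ext.comp_assoc _ _ _ (add_zero 1) (add_zero 0) (by simp),
    Abelian.Ext.mk₀_comp_mk₀]
  rfl

/-- In degree one, `Ext^1(R ⧸ a ^ n, N)` is `Hom(a ^ n, N)` modulo the maps that extend to `R`. -/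
noncomputable def ExtColimit.toHomColimit {a : Ideal R} {N : ModuleCat.{u} R} {T : Type u}
    [AddCommGroup T] [Module R T] (E : ExtColimit a N 1 T) : HomColimit a N T where
  of n := E.of n ∘ₗ homToExt (a ^ n) N
  of_restrict {n m} h φ := by
    rw [LinearMap.comp_apply, LinearMap.comp_apply, ← homToExt_restrict]
    exact E.of_comp h _
  exists_of t := by
    obtain ⟨n, e, rfl⟩ := E.exists_of t
    obtain ⟨φ, rfl⟩ := homToExt_surjective _ _ e
    exact ⟨n, φ, rfl⟩
  of_eq_zero_iff n φ := by
    constructor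
    · intro h
      obtain ⟨m, hm, h2⟩ := E.exists_eq_zero n _ h
      have h3 := (homToExt_restrict (Ideal.pow_le_pow_right hm) N φ).symm.trans h2
      exact ⟨m, hm, (homToExt_eq_zero_iff _ _ _).1 h3⟩
    · rintro ⟨m, hm, h⟩
      have h3 := (homToExt_eq_zero_iff (a ^ m) N
        (φ ∘ₗ Submodule.inclusion (Ideal.pow_le_pow_right hm))).2 h
      rw [LinearMap.comp_apply, ← E.of_comp hm]
      refine Eq.trans (congrArg _ (homToExt_restrict (Ideal.pow_le_pow_right hm) N φ)) ?_
      rw [h3, map_zero]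

/-- Dimension shift: if every `Ext^j(R ⧸ a ^ n, X₂)` vanishes, then the connecting maps turn a
direct limit presentation in degree `i + 1` for `X₁` into one in degree `i` for `X₃`. -/
noncomputable def ExtColimit.ofShortExact {a : Ideal R} {S : ShortComplex (ModuleCat.{u} R)}
    (hS : S.ShortExact) {i : ℕ} {T : Type u} [AddCommGroup T] [Module R T]
    (E : ExtColimit a S.X₁ (i + 1) T)
    (h : ∀ n j (e : Abelian.Ext (ModuleCat.of R (R ⧸ a ^ n)) S.X₂ j), e = 0) :
    ExtColimit a S.X₃ i T where
  of n := E.of n ∘ₗ Abelian.Ext.postcompOfLinear hS.extClass R _ rfl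
  of_comp {n m} hnm e := by
    have := E.of_comp hnm (e.comp hS.extClass rfl)
    rw [← Abelian.Ext.comp_assoc _ _ _ (zero_add i) rfl (by simp)] at this
    exact this
  exists_of t := by
    obtain ⟨n, e, rfl⟩ := E.exists_of t
    obtain ⟨e', rfl⟩ := Abelian.Ext.covariant_sequence_exact₁ _ hS e (h _ _ _) rfl
    exact ⟨n, e', rfl⟩
  exists_eq_zero n e he := by
    obtain ⟨m, hm, h2⟩ := E.exists_eq_zero n _ he
    refine ⟨m, hm, ?_⟩
    have h3 : ((Abelian.Ext.mk₀ (quotPowMap a hm)).comp e (zero_add i)).comp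
        hS.extClass rfl = 0 := by
      rw [Abelian.Ext.comp_assoc _ _ _ (zero_add i) rfl (by simp)]
      exact h2
    obtain ⟨e', he'⟩ := Abelian.Ext.covariant_sequence_exact₃ _ hS _ rfl h3
    rw [← he', h _ _ e', Abelian.Ext.zero_comp]

lemma ext_smul_eq_zero {X Y : ModuleCat.{u} R} {r : R} (hr : ∀ x : X, r • x = 0) {i : ℕ}
    (e : Abelian.Ext X Y i) : r • e = 0 := by
  have : r • 𝟙 X = 0 := by ext x; exact hr x
  have h : r • e = (Abelian.Ext.mk₀ (r • 𝟙 X)).comp e (zero_add i) := by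
    rw [Abelian.Ext.mk₀_smul, Abelian.Ext.smul_comp, Abelian.Ext.mk₀_id_comp]
  rw [h, this, Abelian.Ext.mk₀_zero, Abelian.Ext.zero_comp]

lemma ext_smul_eq_zero' {X Y : ModuleCat.{u} R} {r : R} (hr : ∀ x : Y, r • x = 0) {i : ℕ}
    (e : Abelian.Ext X Y i) : r • e = 0 := by
  have : r • 𝟙 Y = 0 := by ext x; exact hr x
  rw [Abelian.Ext.smul_eq_comp_mk₀, this, Abelian.Ext.mk₀_zero, Abelian.Ext.comp_zero]

/-- Multiplication by `r` on `Ext^i(X, Y)` is zero through `X` and bijective through `Y`. -/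
lemma ext_eq_zero_of_bijective {X Y : ModuleCat.{u} R} {r : R} (hr : ∀ x : X, r • x = 0)
    (hY : Function.Bijective (fun x : Y => r • x)) {i : ℕ} (e : Abelian.Ext X Y i) : e = 0 := by
  let g := (LinearEquiv.ofBijective (LinearMap.lsmul R Y r) hY).toModuleIso
  have h1 : g.hom = r • 𝟙 Y := by ext x; rfl
  have h2 : r • e = e.comp (Abelian.Ext.mk₀ g.hom) (add_zero i) := by
    rw [h1, Abelian.Ext.smul_eq_comp_mk₀]
  have h3 : e = (r • e).comp (Abelian.Ext.mk₀ g.inv) (add_zero i) := by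
    rw [h2]
    simp
  rw [h3, ext_smul_eq_zero hr, Abelian.Ext.zero_comp]

end
end

/-! ### Localization of direct limits of `Hom` -/

section
variable {R : Type*} [CommRing R] (S : Submonoid R)

lemma HomColimit.exists_map {R : Type*} [CommRing R] {a : Ideal R} {N N' T T' : Type*}
    [AddCommGroup N] [Module R N] [AddCommGroup N'] [Module R N'] [AddCommGroup T] [Module R T]
    [AddCommGroup T'] [Module R T'] (H : HomColimit a N T) (H' : HomColimit a N' T')
    (f : N →ₗ[R] N') : ∃ g : T →ₗ[R] T', ∀ n φ, g (H.of n φ) = H'.of n (f ∘ₗ φ) := by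
  refine exists_linearMap_of_directed H.of (fun n => H'.of n ∘ₗ LinearMap.compRight R f) H.exists_of
    ?_ ?_
  · intro i j
    refine ⟨max i j, LinearMap.lcomp R N (Submodule.inclusion (Ideal.pow_le_pow_right
      (le_max_left i j))), LinearMap.lcomp R N (Submodule.inclusion (Ideal.pow_le_pow_right
      (le_max_right i j))), fun e => H.of_restrict (le_max_left i j) e,
      fun e => H.of_restrict (le_max_right i j) e,
      fun e => H'.of_restrict (le_max_left i j) (f ∘ₗ e),
      fun e => H'.of_restrict (le_max_right i j) (f ∘ₗ e)⟩
  · intro n φ h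
    obtain ⟨m, hm, c, hc⟩ := (H.of_eq_zero_iff n φ).1 h
    refine (H'.of_eq_zero_iff n (f ∘ₗ φ)).2 ⟨m, hm, f c, fun x => ?_⟩
    rw [LinearMap.comp_apply, hc, map_smul]

lemma isUnit_algebraMap_end (A : Type*) [CommRing A] [Algebra R A] [IsLocalization S A]
    (N : Type*) [AddCommGroup N] [Module R N] [Module A N] [IsScalarTower R A N] (x : S) :
    IsUnit (algebraMap R (Module.End R N) x) := by
  obtain ⟨v, hv⟩ := IsLocalization.map_units A x
  refine (Module.End.isUnit_iff _).2 ⟨fun t t' h => ?_, fun t => ⟨(↑v⁻¹ : A) • t, ?_⟩⟩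
  · have h' : (v : A) • t = (v : A) • t' := by
      simpa [hv, Module.algebraMap_end_apply] using h
    exact (smul_left_cancel_iff v).1 h'
  · rw [Module.algebraMap_end_apply, ← algebraMap_smul A, ← hv, smul_smul, Units.mul_inv,
      one_smul]

/-- The limit of `Hom(a ^ n, -)` commutes with localization, because each `a ^ n` is finitely
presented. -/
lemma HomColimit.exists_isLocalizedModule [IsNoetherianRing R] (A : Type*) [CommRing A]
    [Algebra R A] [IsLocalization S A] {a : Ideal R} {N N' T T' : Type*}
    [AddCommGroup N] [Module R N] [AddCommGroup N'] [Module R N'] [AddCommGroup T] [Module R T]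
    [AddCommGroup T'] [Module R T'] [Module A T'] [IsScalarTower R A T']
    (H : HomColimit a N T) (H' : HomColimit a N' T')
    (f : N →ₗ[R] N') [IsLocalizedModule S f] : ∃ g : T →ₗ[R] T', IsLocalizedModule S g := by
  obtain ⟨g, hg⟩ := H.exists_map H' f
  have hunit := isUnit_algebraMap_end S A T'
  refine ⟨g, ⟨hunit, ?_, ?_⟩⟩
  · intro t'
    obtain ⟨n, φ', rfl⟩ := H'.exists_of t'
    have := Module.finitePresentation_of_finite R ↥(a ^ n)
    obtain ⟨φ, s, hs⟩ := Module.FinitePresentation.exists_lift_of_isLocalizedModule S f φ'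
    refine ⟨(H.of n φ, s), ?_⟩
    rw [hg, hs]
    exact ((H'.of n).map_smul_of_tower s φ').symm
  · intro t₁ t₂ h
    have h0 : g (t₁ - t₂) = 0 := by rw [map_sub, h, sub_self]
    obtain ⟨n, φ, hφ⟩ := H.exists_of (t₁ - t₂)
    rw [← hφ, hg, H'.of_eq_zero_iff] at h0
    obtain ⟨m, hm, c', hc'⟩ := h0
    obtain ⟨⟨c, s⟩, hs⟩ := IsLocalizedModule.surj S f c'
    dsimp only at hs
    let ψ : ↥(a ^ m) →ₗ[R] N := (s : R) • (φ ∘ₗ Submodule.inclusion (Ideal.pow_le_pow_right hm)) -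
      LinearMap.toSpanSingleton R N c ∘ₗ (a ^ m).subtype
    have hψ : f ∘ₗ ψ = f ∘ₗ (0 : ↥(a ^ m) →ₗ[R] N) := by
      ext x
      have h1 := hc' x
      simp only [LinearMap.comp_apply] at h1
      simp only [ψ, LinearMap.comp_apply, LinearMap.sub_apply, LinearMap.smul_apply, map_sub,
        map_smul, LinearMap.toSpanSingleton_apply, LinearMap.zero_apply, map_zero,
        Submodule.subtype_apply]
      rw [h1, ← hs, Submonoid.smul_def, smul_comm, sub_self]
    obtain ⟨u, hu⟩ := Module.Finite.exists_smul_of_comp_eq_of_isLocalizedModule S f ψ 0 hψ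
    refine ⟨u * s, ?_⟩
    rw [← sub_eq_zero, ← smul_sub, ← hφ, Submonoid.smul_def, ← map_smul, H.of_eq_zero_iff]
    refine ⟨m, hm, (u : R) • c, fun x => ?_⟩
    have h2 := LinearMap.congr_fun hu x
    simp only [ψ, Submonoid.smul_def, LinearMap.smul_apply, LinearMap.sub_apply, smul_zero,
      LinearMap.comp_apply, LinearMap.toSpanSingleton_apply, LinearMap.zero_apply, smul_sub,
      Submodule.subtype_apply, sub_eq_zero] at h2
    rw [LinearMap.smul_apply, Submonoid.coe_mul, mul_smul, h2, smul_comm]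

/-- Restriction of an `A`-linear map on the extension `K` of `I` to an `R`-linear map on `I`. The
ideal `K` is a variable with an equation, so that it can be a power of an extended ideal. -/
def restrictToIdeal (A : Type*) [CommRing A] [Algebra R A] (N : Type*) [AddCommGroup N] [Module R N]
    [Module A N] [IsScalarTower R A N] (I : Ideal R) (K : Ideal A)
    (h : K = I.map (algebraMap R A)) : (K →ₗ[A] N) →ₗ[R] (I →ₗ[R] N) where
  toFun ψ :=
    { toFun := fun x => ψ ⟨algebraMap R A x, h ▸ Ideal.mem_map_of_mem _ x.2⟩
      map_add' := fun x y => by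
        rw [← map_add]; congr 1; ext; simp
      map_smul' := fun r x => by
        refine Eq.trans ?_ (algebraMap_smul A r _)
        exact (congrArg ψ (Subtype.ext (by simp [Algebra.smul_def]))).trans
          (map_smul ψ (algebraMap R A r) ⟨algebraMap R A x, h ▸ Ideal.mem_map_of_mem _ x.2⟩) }
  map_add' _ _ := rfl
  map_smul' _ _ := rfl

lemma restrictToIdeal_bijective (A : Type*) [CommRing A] [Algebra R A] [IsLocalization S A]
    (N : Type*) [AddCommGroup N] [Module R N] [Module A N] [IsScalarTower R A N] (I : Ideal R)
    (K : Ideal A) (h : K = I.map (algebraMap R A)) :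
    Function.Bijective (restrictToIdeal A N I K h) := by
  subst h
  have hunit := isUnit_algebraMap_end S A N
  have hj : IsLocalizedModule S (Algebra.idealMap A I) := Algebra.idealMap_isLocalizedModule A S I
  constructor
  · intro ψ ψ' h
    have h1 : ψ.restrictScalars R = ψ'.restrictScalars R :=
      IsLocalizedModule.ext S (Algebra.idealMap A I) hunit (LinearMap.ext fun x =>
        LinearMap.congr_fun h x)
    exact LinearMap.ext fun x => LinearMap.congr_fun h1 x
  · intro φ
    refine ⟨(IsLocalizedModule.lift S (Algebra.idealMap A I) φ hunit).extendScalarsOfIsLocalization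
      S A, LinearMap.ext fun x => ?_⟩
    exact IsLocalizedModule.lift_apply S (Algebra.idealMap A I) φ hunit x

/-- A limit of `Hom`-modules over a localization `A` is a limit of `Hom`-modules over `R`. -/
noncomputable def HomColimit.restrictScalars (A : Type*) [CommRing A] [Algebra R A]
    [IsLocalization S A] {a : Ideal R} {N T : Type*} [AddCommGroup N] [Module R N] [Module A N]
    [IsScalarTower R A N] [AddCommGroup T] [Module R T] [Module A T] [IsScalarTower R A T]
    (H : HomColimit (a.map (algebraMap R A)) N T) : HomColimit a N T :=
  let r (n : ℕ) : (↥((a.map (algebraMap R A)) ^ n) →ₗ[A] N) ≃ₗ[R] (↥(a ^ n) →ₗ[R] N) :=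
    LinearEquiv.ofBijective _ (restrictToIdeal_bijective S A N (a ^ n)
      ((a.map (algebraMap R A)) ^ n) (Ideal.map_pow _ _ _).symm)
  have hr (n m : ℕ) (h : n ≤ m) (ψ : ↥((a.map (algebraMap R A)) ^ n) →ₗ[A] N) :
    r n ψ ∘ₗ Submodule.inclusion (Ideal.pow_le_pow_right h) =
      r m (ψ ∘ₗ Submodule.inclusion (Ideal.pow_le_pow_right h)) := rfl
  { of := fun n => (H.of n).restrictScalars R ∘ₗ (r n).symm.toLinearMap
    of_restrict := fun {n m} h φ => by
      obtain ⟨ψ, rfl⟩ := (r n).surjective φ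
      change H.of m ((r m).symm _) = H.of n ((r n).symm (r n ψ))
      rw [hr n m h ψ, LinearEquiv.symm_apply_apply, LinearEquiv.symm_apply_apply]
      exact H.of_restrict h ψ
    exists_of := fun t => by
      obtain ⟨n, ψ, rfl⟩ := H.exists_of t
      exact ⟨n, r n ψ, by simp⟩
    of_eq_zero_iff := fun n φ => by
      obtain ⟨ψ, rfl⟩ := (r n).surjective φ
      simp only [LinearMap.comp_apply, LinearEquiv.coe_coe, LinearEquiv.symm_apply_apply,
        LinearMap.coe_restrictScalars]
      rw [H.of_eq_zero_iff]
      refine exists_congr fun m => exists_congr fun h => exists_congr fun c => ?_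
      constructor
      · intro hc x
        have := hc ⟨algebraMap R A x, by
          rw [← Ideal.map_pow]; exact Ideal.mem_map_of_mem _ x.2⟩
        rw [← algebraMap_smul A (x : R) c]
        exact this
      · intro hc
        have h1 : r m (ψ ∘ₗ Submodule.inclusion (Ideal.pow_le_pow_right h)) =
            r m (LinearMap.toSpanSingleton A N c ∘ₗ Submodule.subtype _) := by
          ext x
          refine (hc x).trans ?_
          exact (algebraMap_smul A (x : R) c).symm
        exact fun x => LinearMap.congr_fun ((r m).injective h1) x }
end

/-! ### Melkersson's criterion and minimax modules -/

section Artinian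
variable {R : Type*} [CommRing R]

/-- Melkersson's criterion for a principal ideal: an `x`-power-torsion module `M` is Artinian if
`(0 :_M x)` is. A descending chain `N i` is controlled by the submodules
`x ^ j • (N i ∩ (0 :_M x ^ (j + 1)))` of `(0 :_M x)`, which decrease in both `i` and `j`. -/
lemma isArtinian_of_torsionBy {M : Type*} [AddCommGroup M] [Module R M] (x : R)
    (hx : ∀ z : M, ∃ n : ℕ, x ^ n • z = 0) [IsArtinian R (Submodule.torsionBy R M x)] :
    IsArtinian R M := by
  rw [← monotone_stabilizes_iff_artinian]
  intro f
  let N (i : ℕ) : Submodule R M := OrderDual.ofDual (f i)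
  have hN : Antitone N := fun i j h => f.monotone h
  let L (i j : ℕ) : Submodule R (Submodule.torsionBy R M x) :=
    ((N i ⊓ Submodule.torsionBy R M (x ^ (j + 1))).map (LinearMap.lsmul R M (x ^ j))).comap
      (Submodule.torsionBy R M x).subtype
  have hLmem : ∀ i j (u : Submodule.torsionBy R M x), u ∈ L i j ↔
      ∃ z ∈ N i, x ^ (j + 1) • z = 0 ∧ x ^ j • z = u := by
    intro i j u
    simp [L, and_assoc]
  have hL1 : ∀ i i' j, i ≤ i' → L i' j ≤ L i j := by
    intro i i' j h u hu
    rw [hLmem] at hu ⊢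
    obtain ⟨z, hz, h1, h2⟩ := hu
    exact ⟨z, hN h hz, h1, h2⟩
  have hL2 : ∀ i j j', j ≤ j' → L i j' ≤ L i j := by
    intro i j j' h u hu
    rw [hLmem] at hu ⊢
    obtain ⟨z, hz, h1, h2⟩ := hu
    obtain ⟨d, rfl⟩ := Nat.exists_eq_add_of_le h
    refine ⟨x ^ d • z, Submodule.smul_mem _ _ hz, ?_, ?_⟩
    · rw [smul_smul, ← pow_add, show j + 1 + d = j + d + 1 by omega, h1]
    · rw [smul_smul, ← pow_add, h2]
  -- The diagonal stabilizes at some `k`; together with the columns `j < k` this bounds all `L i j`.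
  obtain ⟨k, hk⟩ := IsArtinian.monotone_stabilizes (R := R) (M := Submodule.torsionBy R M x)
    ⟨fun k => OrderDual.toDual (L k k), fun i j h =>
      ((hL1 i j j h).trans (hL2 i i j h) : L j j ≤ L i i)⟩
  have hk' : ∀ m, k ≤ m → L k k = L m m := hk
  have hcol : ∀ j, ∃ n, ∀ m, n ≤ m → L n j = L m j := fun j =>
    IsArtinian.monotone_stabilizes (R := R) (M := Submodule.torsionBy R M x)
      ⟨fun i => OrderDual.toDual (L i j), fun i i' h => hL1 i i' j h⟩
  choose c hc using hcol
  let n := max k ((Finset.range k).sup c)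
  have hstab : ∀ i, n ≤ i → ∀ j, L n j ≤ L i j := by
    intro i hi j
    by_cases hj : j < k
    · have h1 : c j ≤ n := (Finset.le_sup (f := c) (Finset.mem_range.2 hj)).trans (le_max_right _ _)
      rw [← hc j n h1, hc j i (h1.trans hi)]
    · push Not at hj
      have h1 : L n j ≤ L k k := (hL1 k n j (le_max_left _ _)).trans (hL2 k k j hj)
      have h2 : L (max i j) (max i j) ≤ L i j :=
        (hL1 _ _ _ (le_max_left _ _)).trans (hL2 _ _ _ (le_max_right _ _))
      refine h1.trans (le_of_eq_of_le (hk' _ ?_) h2)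
      exact hj.trans (le_max_right _ _)
  refine ⟨n, fun i hi => ?_⟩
  have main : ∀ j, ∀ z ∈ N n, x ^ j • z = 0 → z ∈ N i := by
    intro j
    induction j with
    | zero => intro z _ h; simp at h; rw [h]; exact zero_mem _
    | succ j ih =>
      intro z hz h
      have hu : x ^ j • z ∈ Submodule.torsionBy R M x := by
        rw [Submodule.mem_torsionBy_iff, smul_smul, ← pow_succ', h]
      have h1 : (⟨x ^ j • z, hu⟩ : Submodule.torsionBy R M x) ∈ L n j :=
        (hLmem _ _ _).2 ⟨z, hz, h, rfl⟩
      obtain ⟨z', hz', h2, h3⟩ := (hLmem _ _ _).1 (hstab i hi j h1)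
      have h4 : z - z' ∈ N i := ih _ (sub_mem hz (hN hi hz')) (by rw [smul_sub, h3, sub_self])
      simpa using add_mem h4 hz'
  refine le_antisymm (α := Submodule R M) ?_ (hN hi)
  intro z hz
  obtain ⟨j, hj⟩ := hx z
  exact main j z hz hj

lemma isArtinian_of_torsionBySet_finset (s : Finset R) {M : Type*} [AddCommGroup M] [Module R M]
    (hs : ∀ x ∈ s, ∀ z : M, ∃ n : ℕ, x ^ n • z = 0)
    (h : IsArtinian R (Submodule.torsionBySet R M (s : Set R))) : IsArtinian R M := by
  classical
  induction s using Finset.induction_on generalizing M with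
  | empty =>
    have : Submodule.torsionBySet R M ((∅ : Finset R) : Set R) = ⊤ := by
      ext; simp [Submodule.mem_torsionBySet_iff]
    rw [this] at h
    exact isArtinian_of_linearEquiv Submodule.topEquiv
  | insert x s _ ih =>
    have : IsArtinian R (Submodule.torsionBy R M x) := by
      refine ih (fun y hy z => ?_) ?_
      · obtain ⟨n, hn⟩ := hs y (Finset.mem_insert_of_mem hy) z
        exact ⟨n, Subtype.ext hn⟩
      · let g : Submodule.torsionBySet R (Submodule.torsionBy R M x) (s : Set R) →ₗ[R]
            Submodule.torsionBySet R M ((insert x s : Finset R) : Set R) :=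
          LinearMap.codRestrict _ ((Submodule.torsionBy R M x).subtype ∘ₗ Submodule.subtype _)
            (fun z => by
              rw [Submodule.mem_torsionBySet_iff]
              rintro ⟨y, hy⟩
              rcases Finset.mem_insert.1 hy with rfl | hy
              · exact z.1.2
              · exact congrArg Subtype.val ((Submodule.mem_torsionBySet_iff _ _).1 z.2 ⟨y, hy⟩))
        refine isArtinian_of_injective g fun z z' hz => ?_
        have h := congrArg Subtype.val hz
        exact Subtype.ext (Subtype.ext h)
    exact isArtinian_of_torsionBy x (hs x (Finset.mem_insert_self _ _))

/-- Melkersson's criterion: an `I`-power-torsion module `M` is Artinian if `(0 :_M I)` is. -/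
theorem isArtinian_of_torsionBySet {I : Ideal R} (hI : I.FG) {M : Type*} [AddCommGroup M]
    [Module R M] (hM : ∀ z : M, ∃ n : ℕ, ∀ r ∈ I ^ n, r • z = 0)
    [h : IsArtinian R (Submodule.torsionBySet R M (I : Set R))] : IsArtinian R M := by
  obtain ⟨s, rfl⟩ := hI
  rw [← Submodule.torsionBySet_eq_torsionBySet_span] at h
  refine isArtinian_of_torsionBySet_finset s (fun x hx z => ?_) h
  obtain ⟨n, hn⟩ := hM z
  exact ⟨n, hn _ (Ideal.pow_mem_pow (Ideal.subset_span hx) n)⟩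

/-- If `I` kills the kernel of a map from `X` to an Artinian module, then multiplication by each
`r ∈ I` factors through its image, so that `I • X` is Artinian. -/
lemma isArtinian_ideal_smul_top {I : Ideal R} (hI : I.FG) {X Y : Type*} [AddCommGroup X]
    [Module R X] [AddCommGroup Y] [Module R Y] (f : X →ₗ[R] Y) [IsArtinian R Y]
    (h : ∀ r ∈ I, ∀ z, f z = 0 → r • z = 0) :
    IsArtinian R (I • ⊤ : Submodule R X) := by
  have key : ∀ r ∈ I, IsArtinian R (LinearMap.range (LinearMap.lsmul R X r)) := by
    intro r hr
    have : IsArtinian R (X ⧸ LinearMap.ker f) := isArtinian_of_linearEquiv f.quotKerEquivRange.symm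
    rw [← Submodule.range_liftQ (LinearMap.ker f) (LinearMap.lsmul R X r) (fun z hz => h r hr z hz)]
    infer_instance
  obtain ⟨s, rfl⟩ := hI
  have : (Submodule.span R (s : Set R) : Ideal R) • (⊤ : Submodule R X) =
      ⨆ r : s, LinearMap.range (LinearMap.lsmul R X (r : R)) := by
    refine le_antisymm (Submodule.smul_le.2 fun r hr z _ => ?_) (iSup_le fun r => ?_)
    · induction hr using Submodule.span_induction with
      | mem r hr => exact Submodule.mem_iSup_of_mem (⟨r, hr⟩ : s) ⟨z, rfl⟩
      | zero => simp
      | add a b _ _ ha hb => rw [add_smul]; exact add_mem ha hb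
      | smul c a _ ha => rw [smul_assoc]; exact Submodule.smul_mem _ _ ha
    · rintro _ ⟨z, rfl⟩
      exact Submodule.smul_mem_smul (Submodule.subset_span r.2) trivial
  rw [this]
  have := fun r : s => key r (Submodule.subset_span r.2)
  infer_instance

lemma exists_pow_smul_eq_zero_of_fg {I : Ideal R} {T : Type*} [AddCommGroup T] [Module R T]
    (hT : ∀ z : T, ∃ n : ℕ, ∀ r ∈ I ^ n, r • z = 0) (F : Submodule R T) (hF : F.FG) :
    ∃ k : ℕ, ∀ r ∈ I ^ k, ∀ z ∈ F, r • z = 0 := by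
  induction F, hF using Submodule.fg_induction with
  | singleton x =>
    obtain ⟨n, hn⟩ := hT x
    refine ⟨n, fun r hr z hz => ?_⟩
    obtain ⟨c, rfl⟩ := Submodule.mem_span_singleton.1 hz
    rw [smul_comm, hn r hr, smul_zero]
  | sup N₁ N₂ _ _ h1 h2 =>
    obtain ⟨k1, h1⟩ := h1
    obtain ⟨k2, h2⟩ := h2
    refine ⟨max k1 k2, fun r hr z hz => ?_⟩
    obtain ⟨z1, hz1, z2, hz2, rfl⟩ := Submodule.mem_sup.1 hz
    rw [smul_add, h1 r (Ideal.pow_le_pow_right (le_max_left _ _) hr) z1 hz1,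
      h2 r (Ideal.pow_le_pow_right (le_max_right _ _) hr) z2 hz2, add_zero]
end Artinian

section Minimax
variable {R : Type*} [CommRing R] {X Y Z : Type*} [AddCommGroup X] [Module R X]
  [AddCommGroup Y] [Module R Y] [AddCommGroup Z] [Module R Z]

lemma IsArtinian.isMinimaxModule [IsArtinian R X] : IsMinimaxModule R X :=
  ⟨⊥, Submodule.fg_bot, inferInstance⟩

lemma IsMinimaxModule.of_finite [Module.Finite R X] : IsMinimaxModule R X :=
  ⟨⊤, Module.Finite.fg_top, inferInstance⟩

lemma IsMinimaxModule.of_injective [IsNoetherianRing R] (hY : IsMinimaxModule R Y) (f : X →ₗ[R] Y)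
    (hf : Function.Injective f) : IsMinimaxModule R X := by
  obtain ⟨N, hN, hA⟩ := hY
  refine ⟨N.comap f, ?_, ?_⟩
  · have : IsNoetherian R N := isNoetherian_of_fg_of_noetherian N hN
    have : IsNoetherian R (N.comap f) :=
      isNoetherian_of_injective (f.restrict (p := N.comap f) (q := N) fun _ h => h)
        fun x y h => Subtype.ext (hf (congrArg Subtype.val h))
    exact Module.Finite.iff_fg.1 inferInstance
  · refine isArtinian_of_injective (Submodule.mapQ (N.comap f) N f le_rfl) ?_
    rw [← LinearMap.ker_eq_bot, Submodule.ker_mapQ, Submodule.mkQ_map_self]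

lemma IsMinimaxModule.of_surjective (hX : IsMinimaxModule R X) (f : X →ₗ[R] Y)
    (hf : Function.Surjective f) : IsMinimaxModule R Y := by
  obtain ⟨N, hN, hA⟩ := hX
  refine ⟨N.map f, hN.map f, isArtinian_of_surjective _
    (Submodule.mapQ N (N.map f) f (Submodule.le_comap_map f N)) ?_⟩
  intro y
  obtain ⟨y, rfl⟩ := Submodule.mkQ_surjective _ y
  obtain ⟨x, rfl⟩ := hf y
  exact ⟨Submodule.Quotient.mk x, rfl⟩

/-- Minimax modules are closed under extensions: lift finite generators along `g`, add the images
of those of `X`, and what remains is an extension of Artinian modules. -/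
lemma IsMinimaxModule.of_exact [IsNoetherianRing R] (f : X →ₗ[R] Y) (g : Y →ₗ[R] Z)
    (h : Function.Exact f g) (hX : IsMinimaxModule R X) (hZ : IsMinimaxModule R Z) :
    IsMinimaxModule R Y := by
  obtain ⟨F, hF, hFA⟩ := hX
  obtain ⟨G, hG, hGA⟩ := hZ
  have hG' : (G ⊓ LinearMap.range g).FG := hG.of_le inf_le_left
  obtain ⟨F₂, hF₂, hF₂'⟩ : ∃ F₂ : Submodule R Y, F₂.FG ∧ F₂.map g = G ⊓ LinearMap.range g := by
    obtain ⟨s, hs⟩ := hG'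
    have hmem : ∀ z : s, ∃ y, g y = z := fun z =>
      (hs ▸ Submodule.subset_span z.2 : (z : Z) ∈ G ⊓ LinearMap.range g).2
    choose y hy using hmem
    refine ⟨Submodule.span R (Set.range y), Submodule.fg_span (Set.finite_range y), ?_⟩
    rw [Submodule.map_span, ← Set.range_comp, ← hs]
    congr 1
    ext z
    simp [hy]
  refine ⟨F.map f ⊔ F₂, (hF.map f).sup hF₂, ?_⟩
  have h1 : F₂ ≤ G.comap g := fun y hy =>
    (hF₂' ▸ Submodule.mem_map_of_mem hy : g y ∈ G ⊓ LinearMap.range g).1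
  have h2 : F.map f ⊔ F₂ ≤ G.comap g := by
    refine sup_le ?_ h1
    rintro _ ⟨x, _, rfl⟩
    simp [h.apply_apply_eq_zero]
  refine isArtinian_of_range_eq_ker
    (Submodule.mapQ F (F.map f ⊔ F₂) f ((Submodule.le_comap_map f F).trans
      (Submodule.comap_mono le_sup_left)))
    (Submodule.mapQ (F.map f ⊔ F₂) G g h2) (le_antisymm ?_ ?_)
  · rintro _ ⟨x, rfl⟩
    obtain ⟨x, rfl⟩ := Submodule.mkQ_surjective _ x
    simp [h.apply_apply_eq_zero]
  · intro y hy
    obtain ⟨y, rfl⟩ := Submodule.mkQ_surjective _ y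
    have hy' : g y ∈ G := by simpa using hy
    obtain ⟨y₂, hy₂, h3⟩ := (hF₂' ▸ ⟨hy', y, rfl⟩ : g y ∈ F₂.map g)
    obtain ⟨x, hx⟩ := (h (y - y₂)).1 (by rw [map_sub, h3, sub_self])
    refine ⟨Submodule.Quotient.mk x, ?_⟩
    rw [Submodule.mapQ_apply, hx]
    refine (Submodule.Quotient.eq _).2 ?_
    rw [sub_sub_cancel_left]
    exact neg_mem (Submodule.mem_sup_right hy₂)
end Minimax

/-! ### Modules that become Artinian after multiplication by a power of an ideal -/

/-- The module `b ^ t • T` is Artinian for some positive integer `t`. -/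
def IsEventuallyArtinian {R : Type*} [CommRing R] (b : Ideal R) (T : Type*) [AddCommGroup T]
    [Module R T] : Prop :=
  ∃ t : ℕ, 0 < t ∧ IsArtinian R (b ^ t • ⊤ : Submodule R T)

section
variable {R : Type*} [CommRing R] {T : Type*} [AddCommGroup T] [Module R T]

lemma isArtinian_ideal_smul {I : Ideal R} (hI : I.FG) {Y : Type*} [AddCommGroup Y] [Module R Y]
    (W : Submodule R T) (f : W →ₗ[R] Y) [IsArtinian R Y]
    (h : ∀ r ∈ I, ∀ z, f z = 0 → r • z = 0) : IsArtinian R (I • W : Submodule R T) := by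
  have h1 := isArtinian_ideal_smul_top hI f h
  have h2 : (I • ⊤ : Submodule R W).map W.subtype = I • W := by
    rw [Submodule.map_smul'', Submodule.map_top, Submodule.range_subtype]
  rw [← h2]
  exact isArtinian_of_linearEquiv
    (Submodule.equivMapOfInjective W.subtype Subtype.val_injective (I • ⊤ : Submodule R W))

/-- For an `a`-power-torsion module and `b ≤ a`, a power of `b` kills the finitely generated part
of a minimax `b ^ t • T`; hence "minimax" can be replaced by "Artinian" at the cost of enlarging
`t`. -/
theorem exists_isMinimaxModule_iff [IsNoetherianRing R] {a b : Ideal R} (hba : b ≤ a)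
    (hT : ∀ z : T, ∃ n : ℕ, ∀ r ∈ a ^ n, r • z = 0) :
    (∃ t : ℕ, 0 < t ∧ IsMinimaxModule R (b ^ t • ⊤ : Submodule R T)) ↔
      IsEventuallyArtinian b T := by
  constructor
  · rintro ⟨t, ht, N, hN, hA⟩
    obtain ⟨k, hk⟩ := exists_pow_smul_eq_zero_of_fg (I := b)
      (T := (b ^ t • ⊤ : Submodule R T)) (fun z => by
        obtain ⟨n, hn⟩ := hT z
        exact ⟨n, fun r hr => Subtype.ext (hn r (Ideal.pow_right_mono hba n hr))⟩) N hN
    refine ⟨k + t, by omega, ?_⟩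
    rw [pow_add, Submodule.mul_smul]
    exact isArtinian_ideal_smul (IsNoetherian.noetherian _) _ N.mkQ fun r hr z hz =>
      hk r hr z ((Submodule.Quotient.mk_eq_zero N).1 hz)
  · rintro ⟨t, ht, h⟩
    exact ⟨t, ht, h.isMinimaxModule⟩

/-- The property passes to the source of a map whose kernel is killed by a power of `b`. -/
lemma IsEventuallyArtinian.of_ker [IsNoetherianRing R] {b : Ideal R} {Y : Type*} [AddCommGroup Y]
    [Module R Y] (f : T →ₗ[R] Y) {k : ℕ} (hf : ∀ r ∈ b ^ k, ∀ z, f z = 0 → r • z = 0)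
    (hY : IsEventuallyArtinian b Y) : IsEventuallyArtinian b T := by
  obtain ⟨t, ht, hA⟩ := hY
  refine ⟨k + t, by omega, ?_⟩
  rw [pow_add, Submodule.mul_smul]
  refine isArtinian_ideal_smul (IsNoetherian.noetherian _) _
    (f.restrict (p := b ^ t • ⊤) (q := b ^ t • ⊤) fun z hz => ?_) fun r hr z hz =>
      Subtype.ext (hf r hr z (congrArg Subtype.val hz))
  have := Submodule.mem_map_of_mem (f := f) hz
  rw [Submodule.map_smul''] at this
  exact Submodule.smul_mono le_rfl le_top this

/-- The property passes to the target of a map whose cokernel is killed by a power of `b`. -/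
lemma IsEventuallyArtinian.of_range {b : Ideal R} {Y : Type*} [AddCommGroup Y]
    [Module R Y] (f : T →ₗ[R] Y) {k : ℕ} (hf : ∀ r ∈ b ^ k, ∀ y, r • y ∈ LinearMap.range f)
    (hT : IsEventuallyArtinian b T) : IsEventuallyArtinian b Y := by
  obtain ⟨t, ht, hA⟩ := hT
  refine ⟨t + k, by omega, ?_⟩
  have h1 : (b ^ (t + k) • ⊤ : Submodule R Y) ≤ (b ^ t • ⊤ : Submodule R T).map f := by
    rw [Submodule.map_smul'', Submodule.map_top, pow_add, Submodule.mul_smul]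
    exact smul_mono_right _ (Submodule.smul_le.2 fun r hr y _ => hf r hr y)
  have h2 : IsArtinian R ((b ^ t • ⊤ : Submodule R T).map f) :=
    isArtinian_of_surjective _ (f.submoduleMap _) (f.submoduleMap_surjective _)
  exact isArtinian_of_le h1

/-- At every prime `q` that is not maximal, the localization of some `b ^ t • T` at `q` vanishes.
The localization is expressed through elements, and `t` may depend on `q`. -/
def VanishesAwayFromMax (b : Ideal R) (T : Type*) [AddCommGroup T] [Module R T] : Prop :=
  ∀ q : Ideal R, q.IsPrime → ¬ q.IsMaximal → ∃ t : ℕ, ∀ z ∈ (b ^ t • ⊤ : Submodule R T),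
    ∃ s ∉ q, s • z = 0

/-- A finitely generated submodule is Artinian if only maximal ideals contain the annihilators of
its elements. -/
lemma isArtinian_of_forall_prime_isMaximal [IsNoetherianRing R] (F : Submodule R T) (hF : F.FG)
    (h : ∀ z ∈ F, ∀ q : Ideal R, q.IsPrime → (∀ r : R, r • z = 0 → r ∈ q) → q.IsMaximal) :
    IsArtinian R F := by
  induction F, hF using Submodule.fg_induction with
  | singleton x =>
    let f := LinearMap.toSpanSingleton R T x
    have : Ring.KrullDimLE 0 (R ⧸ LinearMap.ker f) := by
      refine Ring.KrullDimLE.mk₀ fun P hP => ?_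
      have hmax : (P.comap (Ideal.Quotient.mk (LinearMap.ker f))).IsMaximal := by
        refine h x (Submodule.mem_span_singleton_self x) _ inferInstance fun r hr => ?_
        have : Ideal.Quotient.mk (LinearMap.ker f) r = 0 := Ideal.Quotient.eq_zero_iff_mem.2 hr
        rw [Ideal.mem_comap, this]
        exact zero_mem _
      have := Ideal.map_comap_of_surjective _
        (Ideal.Quotient.mk_surjective (I := LinearMap.ker f)) P
      rcases Ideal.map_eq_top_or_isMaximal_of_surjective _
        (Ideal.Quotient.mk_surjective (I := LinearMap.ker f)) hmax with h1 | h1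
      · rw [this] at h1
        exact absurd h1 hP.ne_top
      · rwa [this] at h1
    have hA : IsArtinianRing (R ⧸ LinearMap.ker f) := isArtinianRing_iff_krullDimLE_zero.2 this
    have hA' : IsArtinian R (R ⧸ LinearMap.ker f) :=
      isArtinian_of_surjective_algebraMap (R := R ⧸ LinearMap.ker f) Ideal.Quotient.mk_surjective
    rw [← LinearMap.range_toSpanSingleton]
    exact isArtinian_of_linearEquiv f.quotKerEquivRange
  | sup N₁ N₂ _ _ h1 h2 =>
    have := h1 fun z hz => h z (Submodule.mem_sup_left hz)
    have := h2 fun z hz => h z (Submodule.mem_sup_right hz)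
    infer_instance

lemma finite_nonmaximal_associatedPrimes [IsNoetherianRing R] (hT : IsMinimaxModule R T) :
    {q ∈ associatedPrimes R T | ¬ q.IsMaximal}.Finite := by
  obtain ⟨N, hN, hA⟩ := hT
  have : Module.Finite R N := Module.Finite.iff_fg.2 hN
  refine (associatedPrimes.finite R N).subset ?_
  rintro q ⟨hq, hmax⟩
  rcases associatedPrimes.subset_union_of_exact N.injective_subtype
    (LinearMap.exact_subtype_mkQ N) hq with h | h
  · exact h
  · exfalso
    obtain ⟨hp, x, hx⟩ := isAssociatedPrime_iff.1 h
    have hker : LinearMap.ker (LinearMap.toSpanSingleton R (T ⧸ N) x) = q := by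
      rw [hx]; ext r; simp [Submodule.mem_colon_singleton]
    have h1 : IsArtinian R (R ⧸ q) := by
      rw [← hker]
      exact isArtinian_of_linearEquiv
        (LinearMap.toSpanSingleton R (T ⧸ N) x).quotKerEquivRange.symm
    have h2 : IsArtinianRing (R ⧸ q) := isArtinian_of_tower R h1
    exact hmax (Ideal.Quotient.maximal_of_isField q (IsArtinianRing.isField_of_isDomain _))

/-- Let `T` be `a`-power-torsion with `(0 :_T a)` minimax. The associated primes of `T` are those
of `(0 :_T a)`, and only finitely many of them are not maximal; so a single `t` makes `b ^ t • T`
vanish at all of them. Then `W = b ^ t • T` is supported at maximal ideals, hence the minimax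
module `(0 :_W a)` is Artinian, and Melkersson's criterion applies to `W`. -/
theorem VanishesAwayFromMax.isEventuallyArtinian [IsNoetherianRing R] {a b : Ideal R}
    (hT : ∀ z : T, ∃ n : ℕ, ∀ r ∈ a ^ n, r • z = 0)
    (hZ : IsMinimaxModule R (Submodule.torsionBySet R T (a : Set R)))
    (h : VanishesAwayFromMax b T) : IsEventuallyArtinian b T := by
  set Z := Submodule.torsionBySet R T (a : Set R) with hZdef
  have hfin := finite_nonmaximal_associatedPrimes hZ
  choose! t ht using h
  let t₀ := hfin.toFinset.sup t + 1
  refine ⟨t₀, by omega, ?_⟩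
  set W : Submodule R T := b ^ t₀ • ⊤
  have hW : ∀ q ∈ associatedPrimes R Z, ¬ q.IsMaximal → ∀ z ∈ W, ∃ s ∉ q, s • z = 0 := by
    intro q hq hm z hz
    refine ht q hq.isPrime hm z (Submodule.smul_mono_left (Ideal.pow_le_pow_right ?_) hz)
    have : t q ≤ hfin.toFinset.sup t := Finset.le_sup (f := t) (hfin.mem_toFinset.2 ⟨hq, hm⟩)
    omega
  have hAss : associatedPrimes R T ⊆ associatedPrimes R Z := by
    intro q hq
    obtain ⟨hp, x, hx⟩ := isAssociatedPrime_iff.1 hq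
    have hmem : ∀ r, r ∈ q ↔ r • x = 0 := fun r => by
      rw [hx, Submodule.mem_colon_singleton, Submodule.mem_bot]
    obtain ⟨n, hn⟩ := hT x
    have haq : a ≤ q := hp.le_of_pow_le (n := n) fun r hr => (hmem r).2 (hn r hr)
    have hxZ : x ∈ Z := (Submodule.mem_torsionBySet_iff _ _).2 fun r => (hmem _).1 (haq r.2)
    refine isAssociatedPrime_iff.2 ⟨hp, ⟨x, hxZ⟩, ?_⟩
    ext r
    rw [hmem, Submodule.mem_colon_singleton, Submodule.mem_bot, Subtype.ext_iff]
    rfl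
  have hmax : ∀ z ∈ W, ∀ q : Ideal R, q.IsPrime → (∀ r : R, r • z = 0 → r ∈ q) → q.IsMaximal := by
    intro z hz q hq hann
    by_contra hm
    obtain ⟨p, hp, hpq⟩ := Ideal.exists_minimalPrimes_le
      (I := Module.annihilator R (R ∙ z)) (J := q) (fun r hr => hann r (by
        have := Module.mem_annihilator.1 hr ⟨z, Submodule.mem_span_singleton_self z⟩
        exact congrArg Subtype.val this))
    have hpm : ¬ p.IsMaximal := fun h => hm (h.eq_of_le hq.ne_top hpq ▸ h)
    have hp' : p ∈ associatedPrimes R Z := hAss (associatedPrimes.subset_of_injective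
      (R ∙ z).injective_subtype
      (Module.associatedPrimes.minimalPrimes_annihilator_subset_associatedPrimes R (R ∙ z) hp))
    obtain ⟨s, hs, hsz⟩ := hW p hp' hpm z hz
    refine hs (hp.1.2 (Module.mem_annihilator.2 ?_))
    rintro ⟨y, hy⟩
    obtain ⟨c, rfl⟩ := Submodule.mem_span_singleton.1 hy
    exact Subtype.ext (by simp [smul_comm s c z, hsz])
  have hZW : IsMinimaxModule R (Submodule.torsionBySet R W (a : Set R)) := by
    let g : Submodule.torsionBySet R W (a : Set R) →ₗ[R] Z :=
      LinearMap.codRestrict _ (W.subtype ∘ₗ Submodule.subtype _) fun z =>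
        (Submodule.mem_torsionBySet_iff _ _).2 fun r =>
          congrArg Subtype.val ((Submodule.mem_torsionBySet_iff _ _).1 z.2 r)
    refine hZ.of_injective g fun z z' hz => ?_
    have h := congrArg Subtype.val hz
    exact Subtype.ext (Subtype.ext h)
  have : IsArtinian R (Submodule.torsionBySet R W (a : Set R)) := by
    obtain ⟨F, hF, hFA⟩ := hZW
    have : IsArtinian R F := isArtinian_of_forall_prime_isMaximal F hF fun z _ q hq hz =>
      hmax z.1.1 z.1.2 q hq fun r hr => hz r (Subtype.ext (Subtype.ext hr))
    exact (isArtinian_iff_submodule_quotient F).2 ⟨this, hFA⟩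
  refine isArtinian_of_torsionBySet (I := a) (IsNoetherian.noetherian _) fun z => ?_
  obtain ⟨n, hn⟩ := hT z
  exact ⟨n, fun r hr => Subtype.ext (hn r hr)⟩

section Localization
variable (S : Submonoid R) (A : Type*) [CommRing A] [Algebra R A] [IsLocalization S A]
  {T' : Type*} [AddCommGroup T'] [Module R T'] [Module A T'] [IsScalarTower R A T']

lemma isArtinian_of_isLocalizedModule (f : T →ₗ[R] T') [IsLocalizedModule S f] [IsArtinian R T] :
    IsArtinian A T' :=
  ((Submodule.localized'gi A S f).strictMono_u).wellFoundedLT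

lemma pow_map_smul_top_eq (f : T →ₗ[R] T') [IsLocalizedModule S f] (b : Ideal R) (t : ℕ) :
    ((b.map (algebraMap R A)) ^ t • ⊤ : Submodule A T') =
      (b ^ t • ⊤ : Submodule R T).localized' A S f := by
  rw [Submodule.localized'_smul, Submodule.localized'_top, Ideal.localized'_eq_map, Ideal.map_pow]

lemma IsEventuallyArtinian.of_isLocalizedModule (f : T →ₗ[R] T') [IsLocalizedModule S f]
    {b : Ideal R} (h : IsEventuallyArtinian b T) :
    IsEventuallyArtinian (b.map (algebraMap R A)) T' := by
  obtain ⟨t, ht, hA⟩ := h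
  refine ⟨t, ht, ?_⟩
  rw [pow_map_smul_top_eq S A f]
  exact isArtinian_of_isLocalizedModule S A
    (Submodule.toLocalized' A S f (b ^ t • ⊤ : Submodule R T))
end Localization

/-- Over a local ring, every element of an Artinian module is killed by a power of each element of
the maximal ideal. -/
lemma exists_pow_smul_eq_zero_of_isArtinian [IsLocalRing R] [IsArtinian R T] {x : R}
    (hx : x ∈ IsLocalRing.maximalIdeal R) (z : T) : ∃ n : ℕ, x ^ n • z = 0 := by
  obtain ⟨n, hn⟩ := IsArtinian.monotone_stabilizes (R := R) (M := T)
    ⟨fun n => OrderDual.toDual (R ∙ (x ^ n • z)), monotone_nat_of_le_succ fun n => by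
      change (R ∙ (x ^ (n + 1) • z) : Submodule R T) ≤ R ∙ (x ^ n • z)
      rw [Submodule.span_singleton_le_iff_mem, pow_succ', mul_smul]
      exact Submodule.smul_mem _ _ (Submodule.mem_span_singleton_self _)⟩
  have h1 : (R ∙ (x ^ n • z) : Submodule R T) = R ∙ (x ^ (n + 1) • z) := hn (n + 1) (Nat.le_succ n)
  have h2 : x ^ n • z ∈ (R ∙ (x ^ (n + 1) • z) : Submodule R T) :=
    h1 ▸ Submodule.mem_span_singleton_self _
  obtain ⟨c, hc⟩ := Submodule.mem_span_singleton.1 h2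
  refine ⟨n, ?_⟩
  have h3 : (1 - c * x) • x ^ n • z = 0 := by
    rw [sub_smul, one_smul, sub_eq_zero, smul_smul, mul_assoc, ← pow_succ', mul_smul, hc]
  have h4 : IsUnit (1 - c * x) := by
    by_contra h
    have h5 : 1 - c * x ∈ IsLocalRing.maximalIdeal R := (IsLocalRing.mem_maximalIdeal _).2 h
    have h6 := Ideal.add_mem _ h5 (Ideal.mul_mem_left _ c hx)
    rw [sub_add_cancel] at h6
    exact (Ideal.ne_top_iff_one _).1 (IsLocalRing.maximalIdeal.isMaximal R).ne_top h6
  exact h4.smul_eq_zero.1 h3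

/-- If the localization of `T` at `p` is eventually Artinian, then some `b ^ t • T` vanishes at
every prime `q` strictly below `p`: an element of `p` outside `q` acts nilpotently on it. -/
lemma exists_smul_eq_zero_of_isLocalizedModule {b : Ideal R} {p q : Ideal R} [p.IsPrime]
    (hq : q.IsPrime) (hqp : q < p) {T' : Type*} [AddCommGroup T'] [Module R T']
    [Module (Localization.AtPrime p) T'] [IsScalarTower R (Localization.AtPrime p) T']
    (f : T →ₗ[R] T') [IsLocalizedModule p.primeCompl f]
    (h : IsEventuallyArtinian (b.map (algebraMap R (Localization.AtPrime p))) T') :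
    ∃ t : ℕ, ∀ z ∈ (b ^ t • ⊤ : Submodule R T), ∃ s ∉ q, s • z = 0 := by
  obtain ⟨t, _, hA⟩ := h
  obtain ⟨x, hxp, hxq⟩ := Set.exists_of_ssubset hqp
  refine ⟨t, fun z hz => ?_⟩
  have hfz : f z ∈ ((b.map (algebraMap R (Localization.AtPrime p))) ^ t • ⊤ :
      Submodule (Localization.AtPrime p) T') := by
    rw [pow_map_smul_top_eq p.primeCompl (Localization.AtPrime p) f]
    exact ⟨z, hz, 1, by simp⟩
  have hx : algebraMap R (Localization.AtPrime p) x ∈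
      IsLocalRing.maximalIdeal (Localization.AtPrime p) :=
    (IsLocalization.AtPrime.to_map_mem_maximal_iff (Localization.AtPrime p) p x).2 hxp
  obtain ⟨n, hn⟩ := exists_pow_smul_eq_zero_of_isArtinian hx
    (⟨f z, hfz⟩ : ((b.map (algebraMap R (Localization.AtPrime p))) ^ t • ⊤ :
      Submodule (Localization.AtPrime p) T'))
  have hn' : f (x ^ n • z) = f 0 := by
    rw [map_smul, map_zero, ← algebraMap_smul (Localization.AtPrime p), map_pow]
    exact congrArg Subtype.val hn
  obtain ⟨s, hs⟩ := IsLocalizedModule.exists_of_eq (S := p.primeCompl) hn'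
  refine ⟨s * x ^ n, fun hmem => ?_, ?_⟩
  · rcases hq.mem_or_mem hmem with h1 | h1
    · exact s.2 (hqp.le h1)
    · exact hxq (hq.mem_of_pow_mem n h1)
  · rw [mul_smul]
    simpa [Submonoid.smul_def] using hs
end

/-! ### Local cohomology modulo torsion -/

section
open CategoryTheory CategoryTheory.Limits Opposite

section
variable {R : Type u} [CommRing R]

lemma ExtColimit.exists_map {a : Ideal R} {M N : ModuleCat.{u} R} {i : ℕ} {T T' : Type u}
    [AddCommGroup T] [Module R T] [AddCommGroup T'] [Module R T'] (E : ExtColimit a M i T)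
    (E' : ExtColimit a N i T') (f : M ⟶ N) :
    ∃ g : T →ₗ[R] T', ∀ n e, g (E.of n e) = E'.of n (e.comp (Abelian.Ext.mk₀ f) (add_zero i)) := by
  refine exists_linearMap_of_directed E.of
    (fun n => E'.of n ∘ₗ (Abelian.Ext.mk₀ f).postcompOfLinear R _ (add_zero i)) E.exists_of ?_ ?_
  · have key : ∀ {n m : ℕ} (h : n ≤ m) (e : Abelian.Ext (ModuleCat.of R (R ⧸ a ^ n)) M i),
        E'.of m (((Abelian.Ext.mk₀ (quotPowMap a h)).comp e (zero_add i)).comp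
          (Abelian.Ext.mk₀ f) (add_zero i)) =
            E'.of n (e.comp (Abelian.Ext.mk₀ f) (add_zero i)) := by
      intro n m h e
      rw [Abelian.Ext.comp_assoc _ _ _ (zero_add i) (add_zero i) (by simp)]
      exact E'.of_comp h _
    intro n m
    exact ⟨max n m,
      (Abelian.Ext.mk₀ (quotPowMap a (le_max_left n m))).precompOfLinear R _ (zero_add i),
      (Abelian.Ext.mk₀ (quotPowMap a (le_max_right n m))).precompOfLinear R _ (zero_add i),
      E.of_comp _, E.of_comp _, key _, key _⟩
  · intro n e he
    obtain ⟨m, h, h2⟩ := E.exists_eq_zero n e he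
    refine (E'.of_comp h _).symm.trans ?_
    refine (congrArg (E'.of m) (Abelian.Ext.comp_assoc _ _ _ (zero_add i) (add_zero i)
      (by simp)).symm).trans ?_
    rw [h2, Abelian.Ext.zero_comp, map_zero]

lemma ExtColimit.exists_pow_smul_eq_zero {a : Ideal R} {M : ModuleCat.{u} R} {i : ℕ} {T : Type u}
    [AddCommGroup T] [Module R T] (E : ExtColimit a M i T) (z : T) :
    ∃ n : ℕ, ∀ r ∈ a ^ n, r • z = 0 := by
  obtain ⟨n, e, rfl⟩ := E.exists_of z
  refine ⟨n, fun r hr => ?_⟩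
  rw [← map_smul, ext_smul_eq_zero, map_zero]
  intro x
  obtain ⟨x, rfl⟩ := Ideal.Quotient.mk_surjective x
  exact Ideal.Quotient.eq_zero_iff_mem.2 (Ideal.mul_mem_right x _ hr)

/-- If a power of `b` kills the kernel `K` of a surjection `M → N`, it kills all
`Ext^j(R ⧸ a ^ n, K)`, hence the kernel and the cokernel of the map induced on local cohomology. -/
theorem ExtColimit.isEventuallyArtinian_iff [IsNoetherianRing R] {a b : Ideal R}
    {M N : Type u} [AddCommGroup M] [Module R M] [AddCommGroup N] [Module R N] {i : ℕ}
    {T T' : Type u} [AddCommGroup T] [Module R T] [AddCommGroup T'] [Module R T']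
    (E : ExtColimit a (ModuleCat.of R M) i T) (E' : ExtColimit a (ModuleCat.of R N) i T')
    (f : M →ₗ[R] N) (hf : Function.Surjective f) (k : ℕ)
    (hk : ∀ r ∈ b ^ k, ∀ z, f z = 0 → r • z = 0) :
    IsEventuallyArtinian b T ↔ IsEventuallyArtinian b T' := by
  have hS := LinearMap.shortExact_shortComplexKer hf
  have hK : ∀ r ∈ b ^ k, ∀ x : LinearMap.ker f, r • x = 0 := fun r hr x =>
    Subtype.ext (hk r hr x x.2)
  obtain ⟨g, hg⟩ := E.exists_map E' (ModuleCat.ofHom f)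
  constructor
  · refine IsEventuallyArtinian.of_range g (k := k) fun r hr y => ?_
    obtain ⟨n, e, rfl⟩ := E'.exists_of y
    obtain ⟨e', he'⟩ := Abelian.Ext.covariant_sequence_exact₃ _ hS (r • e) rfl (by
      rw [Abelian.Ext.smul_comp]
      exact ext_smul_eq_zero' (hK r hr) _)
    refine ⟨E.of n e', (hg n e').trans ?_⟩
    rw [← map_smul]
    exact congrArg _ he'
  · refine IsEventuallyArtinian.of_ker g (k := k) fun r hr z hz => ?_
    obtain ⟨n, e, rfl⟩ := E.exists_of z
    rw [hg] at hz
    obtain ⟨m, h, h2⟩ := E'.exists_eq_zero n _ hz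
    have h3 : ((Abelian.Ext.mk₀ (quotPowMap a h)).comp e (zero_add i)).comp
        (Abelian.Ext.mk₀ (ModuleCat.ofHom f)) (add_zero i) = 0 :=
      (Abelian.Ext.comp_assoc _ _ _ (zero_add i) (add_zero i) (by simp)).trans h2
    obtain ⟨e'', he''⟩ := Abelian.Ext.covariant_sequence_exact₂ _ hS _ h3
    rw [← E.of_comp h, ← map_smul]
    refine (congrArg (fun x => E.of m (r • x)) he''.symm).trans ?_
    rw [← Abelian.Ext.smul_comp, ext_smul_eq_zero' (hK r hr), Abelian.Ext.zero_comp, map_zero]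

/-- The submodule `Γ_a(M)` of the elements killed by a power of `a`. -/
def idealPowTorsion {R : Type*} [CommRing R] (a : Ideal R) (M : Type*) [AddCommGroup M]
    [Module R M] : Submodule R M where
  carrier := {z | ∃ n : ℕ, ∀ r ∈ a ^ n, r • z = 0}
  zero_mem' := ⟨0, fun r _ => smul_zero r⟩
  add_mem' := by
    rintro z z' ⟨n, hn⟩ ⟨m, hm⟩
    exact ⟨max n m, fun r hr => by
      rw [smul_add, hn r (Ideal.pow_le_pow_right (le_max_left _ _) hr),
        hm r (Ideal.pow_le_pow_right (le_max_right _ _) hr), add_zero]⟩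
  smul_mem' := by
    rintro c z ⟨n, hn⟩
    exact ⟨n, fun r hr => by rw [smul_comm, hn r hr, smul_zero]⟩

lemma exists_pow_smul_eq_zero_of_le_idealPowTorsion {R : Type*} [CommRing R] {a : Ideal R}
    {M : Type*} [AddCommGroup M] [Module R M] (F : Submodule R M) (hF : F.FG)
    (h : F ≤ idealPowTorsion a M) : ∃ k : ℕ, ∀ r ∈ a ^ k, ∀ z ∈ F, r • z = 0 := by
  have : Module.Finite R F := Module.Finite.iff_fg.2 hF
  obtain ⟨k, hk⟩ := exists_pow_smul_eq_zero_of_fg (I := a) (T := F) (fun z => by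
    obtain ⟨n, hn⟩ := h z.2
    exact ⟨n, fun r hr => Subtype.ext (hn r hr)⟩) ⊤ Module.Finite.fg_top
  exact ⟨k, fun r hr z hz => congrArg Subtype.val (hk r hr ⟨z, hz⟩ trivial)⟩

lemma eq_zero_of_smul_quotient_idealPowTorsion {R : Type*} [CommRing R] [IsNoetherianRing R]
    {a : Ideal R} {M : Type*} [AddCommGroup M] [Module R M] (d : M ⧸ idealPowTorsion a M)
    (h : ∀ r ∈ a, r • d = 0) : d = 0 := by
  obtain ⟨c, rfl⟩ := Submodule.mkQ_surjective _ d
  have h1 : Submodule.map (LinearMap.toSpanSingleton R M c) a ≤ idealPowTorsion a M := by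
    rintro _ ⟨r, hr, rfl⟩
    exact (Submodule.Quotient.mk_eq_zero _).1 (h r hr)
  obtain ⟨k, hk⟩ := exists_pow_smul_eq_zero_of_le_idealPowTorsion _
    ((IsNoetherian.noetherian a).map _) h1
  refine (Submodule.Quotient.mk_eq_zero _).2 ⟨k + 1, fun r hr => ?_⟩
  rw [pow_succ] at hr
  refine Submodule.mul_induction_on hr (fun x hx y hy => ?_) (fun x y hx hy => ?_)
  · rw [mul_smul]
    exact hk x hx _ ⟨y, hy, rfl⟩
  · rw [add_smul, hx, hy, add_zero]

/-- If `D` has no nonzero element killed by `a`, the elements of the first local cohomology of `D`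
that are killed by `a` come from `Hom(a, D)`: when `φ : a ^ n → D` represents such an element, each
`x ∈ a` has a unique `ψ x ∈ D` with `x • φ z = z • ψ x` for `z` in a high power of `a`, and `ψ`
represents the same class as `φ`. -/
lemma HomColimit.exists_of_one {R : Type*} [CommRing R] [IsNoetherianRing R] {a : Ideal R}
    {D T : Type*} [AddCommGroup D] [Module R D] [AddCommGroup T] [Module R T]
    (H : HomColimit a D T) (hD : ∀ d : D, (∀ r ∈ a, r • d = 0) → d = 0) (t : T)
    (ht : ∀ r ∈ a, r • t = 0) : ∃ φ, H.of 1 φ = t := by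
  have hD' : ∀ (m : ℕ) (d : D), (∀ r ∈ a ^ m, r • d = 0) → d = 0 := by
    intro m
    induction m with
    | zero => intro d h; simpa using h 1 (by simp)
    | succ m ih =>
      refine fun d h => ih d fun r hr => hD _ fun s hs => ?_
      rw [smul_smul]
      exact h _ (by rw [pow_succ']; exact Ideal.mul_mem_mul hs hr)
  obtain ⟨n, φ, rfl⟩ := H.exists_of t
  obtain ⟨m, hm, h⟩ : ∃ m, ∃ h : n ≤ m, ∀ x ∈ a, ∃ d : D, ∀ z : ↥(a ^ m),
      x • φ (Submodule.inclusion (Ideal.pow_le_pow_right h) z) = (z : R) • d := by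
    obtain ⟨s, hs⟩ := IsNoetherian.noetherian a
    have h1 : ∀ x : s, ∃ m, ∃ h : n ≤ m, ∃ d : D, ∀ z : ↥(a ^ m),
        (x : R) • φ (Submodule.inclusion (Ideal.pow_le_pow_right h) z) = (z : R) • d := by
      intro x
      have := ht x (hs ▸ Submodule.subset_span x.2)
      rw [← map_smul, H.of_eq_zero_iff] at this
      exact this
    choose m hm d hd using h1
    let m' := max n (Finset.univ.sup m)
    have hm' : ∀ x, m x ≤ m' := fun x =>
      (Finset.le_sup (Finset.mem_univ x)).trans (le_max_right _ _)
    refine ⟨m', le_max_left _ _, fun x hx => ?_⟩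
    rw [← hs] at hx
    induction hx using Submodule.span_induction with
    | mem x hx =>
      exact ⟨d ⟨x, hx⟩, fun z => hd ⟨x, hx⟩ ⟨z, Ideal.pow_le_pow_right (hm' _) z.2⟩⟩
    | zero => exact ⟨0, fun z => by simp⟩
    | add x y _ _ hx hy =>
      obtain ⟨d, hd⟩ := hx
      obtain ⟨e, he⟩ := hy
      exact ⟨d + e, fun z => by rw [add_smul, hd, he, smul_add]⟩
    | smul r x _ hx =>
      obtain ⟨d, hd⟩ := hx
      exact ⟨r • d, fun z => by rw [smul_assoc, hd, smul_comm]⟩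
  choose! ψ hψ using h
  have huniq : ∀ d d' : D, (∀ z ∈ a ^ m, z • d = z • d') → d = d' := fun d d' h =>
    sub_eq_zero.1 (hD' m _ fun z hz => by rw [smul_sub, h z hz, sub_self])
  let Ψ : ↥(a ^ 1) →ₗ[R] D :=
    { toFun := fun x => ψ x
      map_add' := fun x y => by
        have hx : (x : R) ∈ a := by simpa using x.2
        have hy : (y : R) ∈ a := by simpa using y.2
        refine huniq _ _ fun z hz => ?_
        rw [smul_add, ← hψ _ hx ⟨z, hz⟩, ← hψ _ hy ⟨z, hz⟩, ← add_smul]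
        exact (hψ _ (add_mem hx hy) ⟨z, hz⟩).symm
      map_smul' := fun r x => by
        have hx : (x : R) ∈ a := by simpa using x.2
        refine huniq _ _ fun z hz => ?_
        rw [RingHom.id_apply, smul_comm, ← hψ _ hx ⟨z, hz⟩, ← smul_assoc]
        exact (hψ _ (Ideal.mul_mem_left _ r hx) ⟨z, hz⟩).symm }
  refine ⟨Ψ, ?_⟩
  have hle : 1 ≤ max m 1 := le_max_right _ _
  rw [← H.of_restrict hle Ψ, ← H.of_restrict (hm.trans (le_max_left m 1)) φ]
  congr 1
  refine LinearMap.ext fun x => ?_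
  have hxa : (x : R) ∈ a := by simpa using Ideal.pow_le_pow_right hle x.2
  have hxm : (x : R) ∈ a ^ m := Ideal.pow_le_pow_right (le_max_left m 1) x.2
  refine huniq _ _ fun z hz => ?_
  refine (hψ x hxa ⟨z, hz⟩).symm.trans ?_
  refine (map_smul φ _ _).symm.trans (Eq.trans (congrArg φ (Subtype.ext ?_)) (map_smul φ z _))
  exact mul_comm (x : R) z

/-- Dividing out power-torsion elements is injective on the first local cohomology: a map from
`a ^ m` into `Γ_a(N)` has its image killed by some `a ^ k`, so it vanishes on `a ^ (k + m)`. -/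
lemma HomColimit.injective_of_ker_le {R : Type*} [CommRing R] [IsNoetherianRing R] {a : Ideal R}
    {N N' T T' : Type*}
    [AddCommGroup N] [Module R N] [AddCommGroup N'] [Module R N'] [AddCommGroup T] [Module R T]
    [AddCommGroup T'] [Module R T'] (H : HomColimit a N T) (H' : HomColimit a N' T')
    (f : N →ₗ[R] N') (hf : Function.Surjective f) (hker : LinearMap.ker f ≤ idealPowTorsion a N)
    (g : T →ₗ[R] T') (hg : ∀ n φ, g (H.of n φ) = H'.of n (f ∘ₗ φ)) : Function.Injective g := by
  rw [injective_iff_map_eq_zero]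
  intro t ht
  obtain ⟨n, φ, rfl⟩ := H.exists_of t
  rw [hg, H'.of_eq_zero_iff] at ht
  obtain ⟨m, hm, c', hc'⟩ := ht
  obtain ⟨c, rfl⟩ := hf c'
  let ψ : ↥(a ^ m) →ₗ[R] N := φ ∘ₗ Submodule.inclusion (Ideal.pow_le_pow_right hm) -
    LinearMap.toSpanSingleton R N c ∘ₗ (a ^ m).subtype
  have hψ : LinearMap.range ψ ≤ idealPowTorsion a N := by
    rintro _ ⟨x, rfl⟩
    refine hker ?_
    rw [LinearMap.mem_ker, LinearMap.sub_apply, map_sub, sub_eq_zero]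
    refine (hc' x).trans ?_
    simp
  obtain ⟨k, hk⟩ := exists_pow_smul_eq_zero_of_le_idealPowTorsion _
    (Module.Finite.iff_fg.1 (inferInstance : Module.Finite R (LinearMap.range ψ))) hψ
  have h0 : ∀ x (hx : x ∈ a ^ (k + m)),
      ψ ⟨x, Ideal.pow_le_pow_right (Nat.le_add_left m k) hx⟩ = 0 := by
    intro x hx
    have hx' := hx
    rw [pow_add] at hx'
    have h1 : ∀ x ∈ a ^ k * a ^ m, ∃ h : x ∈ a ^ m, ψ ⟨x, h⟩ = 0 := by
      intro x hx
      refine Submodule.mul_induction_on hx (fun r hr y hy => ?_) ?_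
      · refine ⟨Ideal.mul_mem_left _ r hy, ?_⟩
        exact (map_smul ψ r ⟨y, hy⟩).trans (hk r hr _ ⟨_, rfl⟩)
      · rintro x y ⟨hx, h1⟩ ⟨hy, h2⟩
        refine ⟨add_mem hx hy, ?_⟩
        exact (map_add ψ ⟨x, hx⟩ ⟨y, hy⟩).trans (by rw [h1, h2, add_zero])
    exact (h1 x hx').2
  refine (H.of_eq_zero_iff n φ).2 ⟨k + m, hm.trans (Nat.le_add_left m k), c, fun x => ?_⟩
  exact sub_eq_zero.1 (h0 x x.2)
end
end

/-! ### Minimaxness of the elements killed by the ideal -/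

section
open CategoryTheory CategoryTheory.Limits Opposite

section
variable {R : Type u} [CommRing R]

lemma shortExact_of_exact {N J C : Type u} [AddCommGroup N] [Module R N] [AddCommGroup J]
    [Module R J] [AddCommGroup C] [Module R C] (ι : N →ₗ[R] J) (π : J →ₗ[R] C)
    (h : Function.Exact ι π) (hι : Function.Injective ι) (hπ : Function.Surjective π) :
    (ModuleCat.shortComplexOfCompEqZero ι π h.linearMap_comp_eq_zero).ShortExact :=
  ModuleCat.shortComplex_shortExact _ h hι hπ

lemma exact_ext_postcomp₂ {S : ShortComplex (ModuleCat.{u} R)} (hS : S.ShortExact)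
    (X : ModuleCat.{u} R) (i : ℕ) :
    Function.Exact ((Abelian.Ext.mk₀ S.f).postcompOfLinear R X (add_zero i))
      ((Abelian.Ext.mk₀ S.g).postcompOfLinear R X (add_zero i)) := by
  intro e
  refine ⟨Abelian.Ext.covariant_sequence_exact₂ _ hS e, ?_⟩
  rintro ⟨e, rfl⟩
  refine (Abelian.Ext.comp_assoc _ _ _ (add_zero i) (add_zero 0) (by simp)).trans ?_
  rw [Abelian.Ext.mk₀_comp_mk₀, S.zero, Abelian.Ext.mk₀_zero, Abelian.Ext.comp_zero]

lemma exact_ext_postcomp₃ {S : ShortComplex (ModuleCat.{u} R)} (hS : S.ShortExact)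
    (X : ModuleCat.{u} R) (i : ℕ) :
    Function.Exact ((Abelian.Ext.mk₀ S.g).postcompOfLinear R X (add_zero i))
      (hS.extClass.postcompOfLinear R X (rfl : i + 1 = i + 1)) := by
  intro e
  refine ⟨Abelian.Ext.covariant_sequence_exact₃ _ hS e rfl, ?_⟩
  rintro ⟨e, rfl⟩
  refine (Abelian.Ext.comp_assoc _ _ _ (add_zero i) (zero_add 1) (by simp)).trans ?_
  rw [hS.comp_extClass, Abelian.Ext.comp_zero]

lemma isArtinian_ext (X Y : ModuleCat.{u} R) [IsNoetherianRing R] [Module.Finite R X]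
    [IsArtinian R Y] (i : ℕ) : IsArtinian R (Abelian.Ext X Y i) := by
  induction i generalizing X with
  | zero =>
    obtain ⟨n, s, hs⟩ := Module.Finite.exists_fin (R := R) (M := X)
    have : IsArtinian R (X →ₗ[R] Y) :=
      isArtinian_of_injective (LinearMap.pi fun i => LinearMap.applyₗ (s i) :
        (X →ₗ[R] Y) →ₗ[R] (Fin n → Y)) fun f g h =>
        LinearMap.ext_on_range hs fun i => congrFun h i
    exact isArtinian_of_linearEquiv (Abelian.Ext.linearEquiv₀.trans ModuleCat.homLinearEquiv).symm
  | succ n ih =>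
    obtain ⟨P, _, _, _, _, f, hf⟩ := Module.exists_finite_presentation R X
    let exac := LinearMap.shortExact_shortComplexKer hf
    have := ih f.shortComplexKer.X₁
    exact isArtinian_of_surjective _ (exac.extClass.precompOfLinear R Y (add_comm 1 n))
      (precomp_extClass_surjective_of_projective_X₂ Y exac n)

lemma IsMinimaxModule.abelianExt [IsNoetherianRing R] (X : ModuleCat.{u} R) [Module.Finite R X]
    {Y : Type u} [AddCommGroup Y] [Module R Y] (hY : IsMinimaxModule R Y) (i : ℕ) :
    IsMinimaxModule R (Abelian.Ext X (ModuleCat.of R Y) i) := by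
  obtain ⟨F, hF, hA⟩ := hY
  have : Module.Finite R F := Module.Finite.iff_fg.2 hF
  have hS := shortExact_of_exact F.subtype F.mkQ (LinearMap.exact_subtype_mkQ F)
    F.injective_subtype F.mkQ_surjective
  refine IsMinimaxModule.of_exact _ _ (exact_ext_postcomp₂ hS X i) ?_ ?_
  · have : Module.Finite R (ModuleCat.of R F) := this
    exact IsMinimaxModule.of_finite
  · have : IsArtinian R (ModuleCat.of R (Y ⧸ F)) := hA
    have := isArtinian_ext X (ModuleCat.of R (Y ⧸ F)) i
    exact IsArtinian.isMinimaxModule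

/-- If `D` has no nonzero element killed by `a`, then `(0 :_T a)` in degree one is contained in the
image of `Ext^1(R ⧸ a, D)`. -/
lemma ExtColimit.isMinimaxModule_torsionBySet [IsNoetherianRing R] {a : Ideal R}
    {D T : Type u} [AddCommGroup D] [Module R D] [AddCommGroup T] [Module R T]
    (E : ExtColimit a (ModuleCat.of R D) 1 T) (hD : ∀ d : D, (∀ r ∈ a, r • d = 0) → d = 0)
    (h : IsMinimaxModule R
      (Abelian.Ext (ModuleCat.of R (R ⧸ a ^ 1)) (ModuleCat.of R D) 1)) :
    IsMinimaxModule R (Submodule.torsionBySet R T (a : Set R)) := by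
  have h1 : IsMinimaxModule R (LinearMap.range (E.of 1)) :=
    h.of_surjective (E.of 1).rangeRestrict (E.of 1).surjective_rangeRestrict
  have h2 : Submodule.torsionBySet R T (a : Set R) ≤ LinearMap.range (E.of 1) := by
    intro t ht
    obtain ⟨φ, hφ⟩ := E.toHomColimit.exists_of_one hD t fun r hr =>
      (Submodule.mem_torsionBySet_iff _ _).1 ht ⟨r, hr⟩
    exact ⟨_, hφ⟩
  exact h1.of_injective (Submodule.inclusion h2) (Submodule.inclusion_injective h2)

section Fractions
variable {N J C : Type u} [AddCommGroup N] [Module R N] [AddCommGroup J] [Module R J]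
  [AddCommGroup C] [Module R C] {ι : N →ₗ[R] J} {π : J →ₗ[R] C} {a b : Ideal R} {y : R}

lemma bijective_pow_smul (hy : Function.Bijective fun x : J => y • x) (n : ℕ) :
    Function.Bijective fun x : J => y ^ n • x := by
  have : (fun x : J => y ^ n • x) = (fun x : J => y • x)^[n] := (smul_iterate y n).symm
  exact this ▸ hy.iterate n

/-- A module on which some element of `a` acts bijectively has no local cohomology. -/
lemma ext_eq_zero_of_bijective_smul (hya : y ∈ a) (hy : Function.Bijective fun x : J => y • x)
    (n i : ℕ)
    (e : Abelian.Ext (ModuleCat.of R (R ⧸ a ^ n)) (ModuleCat.of R J) i) : e = 0 := by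
  refine ext_eq_zero_of_bijective (r := y ^ n) (fun x => ?_) (bijective_pow_smul hy n) e
  obtain ⟨x, rfl⟩ := Ideal.Quotient.mk_surjective x
  exact Ideal.Quotient.eq_zero_iff_mem.2 (Ideal.mul_mem_right x _ (Ideal.pow_mem_pow hya n))

/-- Dimension shift along `0 → N → J → C → 0` when some `y ∈ a` acts bijectively on `J`. -/
noncomputable def ExtColimit.ofExact (h : Function.Exact ι π)
    (hι : Function.Injective ι) (hπ : Function.Surjective π) (hya : y ∈ a)
    (hy : Function.Bijective fun x : J => y • x) {i : ℕ} {T : Type u} [AddCommGroup T] [Module R T]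
    (E : ExtColimit a (ModuleCat.of R N) (i + 1) T) : ExtColimit a (ModuleCat.of R C) i T :=
  ExtColimit.ofShortExact (shortExact_of_exact ι π h hι hπ) E fun n j e =>
    ext_eq_zero_of_bijective_smul hya hy n j e

/-- Dividing by `y ^ t` in `J` maps `N` onto `(0 :_C y ^ t)`. -/
lemma torsionBy_le_range_of_bijective_smul (h : Function.Exact ι π)
    (hπ : Function.Surjective π) (hy : Function.Bijective fun x : J => y • x) (t : ℕ) :
    ∃ q : N →ₗ[R] C, Submodule.torsionBy R C (y ^ t) ≤ LinearMap.range q := by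
  let e := LinearEquiv.ofBijective (LinearMap.lsmul R J (y ^ t)) (bijective_pow_smul hy t)
  refine ⟨π ∘ₗ e.symm.toLinearMap ∘ₗ ι, fun c hc => ?_⟩
  obtain ⟨x, rfl⟩ := hπ c
  rw [Submodule.mem_torsionBy_iff, ← map_smul] at hc
  obtain ⟨ν, hν⟩ := (h _).1 hc
  refine ⟨ν, congrArg π ?_⟩
  exact (congrArg e.symm hν).trans (e.symm_apply_apply x)

/-- The dimension shift to degree zero identifies the first local cohomology `T` of `N` with
`Γ_a(C)`. If `b ^ t • T` is Artinian, then `Γ_a(C)` is minimax: multiplication by `y ^ t` on it has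
Artinian image, and its kernel lies in the finitely generated module `(0 :_C y ^ t)`. -/
lemma isMinimaxModule_idealPowTorsion (h : Function.Exact ι π)
    (hι : Function.Injective ι) (hπ : Function.Surjective π) (hya : y ∈ a)
    (hy : Function.Bijective fun x : J => y • x) [IsNoetherianRing R] [Module.Finite R N]
    {T : Type u} [AddCommGroup T] [Module R T] (E : ExtColimit a (ModuleCat.of R N) 1 T)
    (hyb : y ∈ b) (hT : IsEventuallyArtinian b T) : IsMinimaxModule R (idealPowTorsion a C) := by
  let E₀ : ExtColimit a (ModuleCat.of R C) 0 T := E.ofExact h hι hπ hya hy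
  -- A homomorphism `R ⧸ a ^ n → C` is determined by its value at `1`.
  let ev (n : ℕ) : Abelian.Ext (ModuleCat.of R (R ⧸ a ^ n)) (ModuleCat.of R C) 0 →ₗ[R] C :=
    LinearMap.applyₗ (Submodule.Quotient.mk 1 : R ⧸ a ^ n) ∘ₗ
      (Abelian.Ext.linearEquiv₀.trans ModuleCat.homLinearEquiv).toLinearMap
  have hev : ∀ n (f : ModuleCat.of R (R ⧸ a ^ n) ⟶ ModuleCat.of R C),
      ev n (Abelian.Ext.mk₀ f) = f.hom (Submodule.Quotient.mk 1 : R ⧸ a ^ n) := by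
    intro n f
    have : Abelian.Ext.linearEquiv₀ (R := R) (Abelian.Ext.mk₀ f) = f :=
      (Abelian.Ext.mk₀_bijective _ _).1 (Abelian.Ext.mk₀_linearEquiv₀_apply _)
    exact congrArg (fun k => k.hom (Submodule.Quotient.mk 1 : R ⧸ a ^ n)) this
  have hcomp : ∀ {n m : ℕ} (h : n ≤ m)
      (e : Abelian.Ext (ModuleCat.of R (R ⧸ a ^ n)) (ModuleCat.of R C) 0),
      ev m ((Abelian.Ext.mk₀ (quotPowMap a h)).comp e (zero_add 0)) = ev n e := by
    intro n m h e
    obtain ⟨f, rfl⟩ := (Abelian.Ext.mk₀_bijective _ _).2 e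
    rw [Abelian.Ext.mk₀_comp_mk₀, hev, hev]
    rfl
  obtain ⟨g, hg⟩ := exists_linearMap_of_directed E₀.of ev E₀.exists_of
    (fun n m => ⟨max n m,
      (Abelian.Ext.mk₀ (quotPowMap a (le_max_left n m))).precompOfLinear R _ (zero_add 0),
      (Abelian.Ext.mk₀ (quotPowMap a (le_max_right n m))).precompOfLinear R _ (zero_add 0),
      E₀.of_comp _, E₀.of_comp _, hcomp _, hcomp _⟩)
    (fun n e he => by
      obtain ⟨m, h, h2⟩ := E₀.exists_eq_zero n e he
      rw [← hcomp h, h2, map_zero])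
  have hle : idealPowTorsion a C ≤ LinearMap.range g := by
    rintro c ⟨n, hn⟩
    let f : ModuleCat.of R (R ⧸ a ^ n) ⟶ ModuleCat.of R C :=
      ModuleCat.ofHom (Submodule.liftQ (a ^ n) (LinearMap.toSpanSingleton R C c) hn)
    refine ⟨E₀.of n (Abelian.Ext.mk₀ f), ?_⟩
    rw [hg, hev]
    exact one_smul R c
  obtain ⟨t, _, hA⟩ := hT
  let w : LinearMap.range g →ₗ[R] C := LinearMap.lsmul R C (y ^ t) ∘ₗ (LinearMap.range g).subtype
  have h1 : IsMinimaxModule R (LinearMap.ker w) := by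
    obtain ⟨q, hq⟩ := torsionBy_le_range_of_bijective_smul h hπ hy t
    refine (IsMinimaxModule.of_finite (R := R) (X := LinearMap.range q)).of_injective
      (LinearMap.codRestrict _ ((LinearMap.range g).subtype ∘ₗ (LinearMap.ker w).subtype)
        fun x => hq x.2) fun x x' hx => ?_
    have hx := congrArg Subtype.val hx
    exact Subtype.ext (Subtype.ext hx)
  have h2 : IsArtinian R (LinearMap.range w) := by
    have : IsArtinian R ((b ^ t • ⊤ : Submodule R T).map g) :=
      isArtinian_of_surjective _ (g.submoduleMap _) (g.submoduleMap_surjective _)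
    refine isArtinian_of_le (t := (b ^ t • ⊤ : Submodule R T).map g) ?_
    rintro _ ⟨⟨_, z, rfl⟩, rfl⟩
    exact ⟨y ^ t • z, Submodule.smul_mem_smul (Ideal.pow_mem_pow hyb t) trivial, map_smul g _ _⟩
  have h3 : IsMinimaxModule R (LinearMap.range g) :=
    IsMinimaxModule.of_exact (LinearMap.ker w).subtype w.rangeRestrict
      (fun x => by simp [Subtype.ext_iff]) h1 IsArtinian.isMinimaxModule
  exact h3.of_injective (Submodule.inclusion hle) (Submodule.inclusion_injective hle)

/-- The second local cohomology of `N` is the first one of `C`, which embeds in that of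
`D = C ⧸ Γ_a(C)`. There the elements killed by `a` come from `Ext^1(R ⧸ a, D)`, which lies between
`Ext^1(R ⧸ a, C)`, a submodule of the finitely generated `Ext^2(R ⧸ a, N)`, and the minimax module
`Ext^2(R ⧸ a, Γ_a(C))`. -/
theorem isMinimaxModule_torsionBySet_two (h : Function.Exact ι π)
    (hι : Function.Injective ι) (hπ : Function.Surjective π) (hya : y ∈ a)
    (hy : Function.Bijective fun x : J => y • x) [IsNoetherianRing R] [Module.Finite R N]
    {T : Type u} [AddCommGroup T] [Module R T] (E : ExtColimit a (ModuleCat.of R N) 2 T)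
    (hC : IsMinimaxModule R (idealPowTorsion a C)) :
    IsMinimaxModule R (Submodule.torsionBySet R T (a : Set R)) := by
  let D := C ⧸ idealPowTorsion a C
  obtain ⟨E'⟩ := nonempty_extColimit a D 0
  let X := ModuleCat.of R (R ⧸ a ^ 1)
  have hS := shortExact_of_exact ι π h hι hπ
  have hSD := shortExact_of_exact (idealPowTorsion a C).subtype (idealPowTorsion a C).mkQ
    (LinearMap.exact_subtype_mkQ _) (Submodule.injective_subtype _) (Submodule.mkQ_surjective _)
  have h1 : IsMinimaxModule R (Abelian.Ext X (ModuleCat.of R C) 1) := by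
    refine (IsMinimaxModule.of_finite (R := R)
      (X := Abelian.Ext X (ModuleCat.of R N) 2)).of_injective
      (hS.extClass.postcompOfLinear R X (rfl : 1 + 1 = 2)) ?_
    rw [injective_iff_map_eq_zero]
    intro e he
    obtain ⟨e', rfl⟩ := Abelian.Ext.covariant_sequence_exact₃ _ hS e rfl he
    rw [ext_eq_zero_of_bijective_smul hya hy 1 1 e', Abelian.Ext.zero_comp]
  have h2 : IsMinimaxModule R (Abelian.Ext X (ModuleCat.of R D) 1) :=
    IsMinimaxModule.of_exact _ _ (exact_ext_postcomp₃ hSD X 1) h1 (hC.abelianExt X 2)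
  have h3 := E'.isMinimaxModule_torsionBySet eq_zero_of_smul_quotient_idealPowTorsion h2
  let H := (E.ofExact h hι hπ hya hy).toHomColimit
  obtain ⟨g, hg⟩ := H.exists_map E'.toHomColimit (idealPowTorsion a C).mkQ
  have hinj : Function.Injective g := H.injective_of_ker_le E'.toHomColimit _
    (Submodule.mkQ_surjective _) (Submodule.ker_mkQ _).le g hg
  refine h3.of_injective (g.restrict fun t ht => (Submodule.mem_torsionBySet_iff _ _).2 fun r => ?_)
    fun x x' hx => Subtype.ext (hinj (congrArg Subtype.val hx))
  rw [← map_smul, (Submodule.mem_torsionBySet_iff _ _).1 ht r, map_zero]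
end Fractions
end
end

/-! ### The local-global principle -/

/-- Prime avoidance over the associated primes of `N`. -/
lemma exists_mem_isSMulRegular {R : Type*} [CommRing R] [IsNoetherianRing R] (b : Ideal R)
    {N : Type*} [AddCommGroup N] [Module R N] [Module.Finite R N]
    (hN : ∀ d : N, (∀ r ∈ b, r • d = 0) → d = 0) : ∃ y ∈ b, IsSMulRegular N y := by
  by_contra! hb
  have h1 : (b : Set R) ⊆ ⋃ q ∈ associatedPrimes R N, q := by
    rw [biUnion_associatedPrimes_eq_compl_regular]
    exact hb
  obtain ⟨q, hq, hbq⟩ := (Ideal.subset_union_prime_finite (associatedPrimes.finite R N) (f := id)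
    ⊥ ⊥ fun q hq _ _ => hq.isPrime).1 h1
  obtain ⟨hp, x, hx⟩ := isAssociatedPrime_iff.1 hq
  have hmem : ∀ r, r ∈ q ↔ r • x = 0 := fun r => by
    rw [hx, Submodule.mem_colon_singleton, Submodule.mem_bot]
  have hx0 : x = 0 := hN x fun r hr => (hmem r).1 (hbq hr)
  exact hp.one_notMem ((hmem 1).2 (by rw [hx0, smul_zero]))

lemma bijective_smul_localizedModule {R : Type*} [CommRing R] (S : Submonoid R) {J : Type*}
    [AddCommGroup J] [Module R J] {y : R} (hy : Function.Bijective fun x : J => y • x) :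
    Function.Bijective fun x : LocalizedModule S J => algebraMap R (Localization S) y • x := by
  have h : (fun x : LocalizedModule S J => algebraMap R (Localization S) y • x) =
      LocalizedModule.map S (LinearMap.lsmul R J y) := by
    ext x
    induction x using LocalizedModule.induction_on with
    | _ m s =>
      rw [LocalizedModule.map_mk]
      exact (algebraMap_smul _ _ _).trans (LocalizedModule.smul'_mk y m s)
  rw [h]
  exact ⟨LocalizedModule.map_injective S _ hy.1, LocalizedModule.map_surjective S _ hy.2⟩

lemma smul_eq_zero_of_localizedModule_map_eq_zero {R : Type*} [CommRing R] (S : Submonoid R)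
    {M N : Type*} [AddCommGroup M] [Module R M] [AddCommGroup N] [Module R N] (f : M →ₗ[R] N)
    (I : Ideal R) (h : ∀ r ∈ I, ∀ z, f z = 0 → r • z = 0) :
    ∀ r ∈ I.map (algebraMap R (Localization S)), ∀ z, LocalizedModule.map S f z = 0 →
      r • z = 0 := by
  intro r hr z hz
  have hz' : z ∈ LinearMap.range (LocalizedModule.map S (LinearMap.ker f).subtype) :=
    (LocalizedModule.map_exact S _ f (LinearMap.exact_subtype_ker_map f) z).1 hz
  obtain ⟨w, rfl⟩ := hz'
  induction w using LocalizedModule.induction_on with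
  | _ m s =>
    rw [LocalizedModule.map_mk]
    induction hr using Submodule.span_induction with
    | mem r hr =>
      obtain ⟨r, hr, rfl⟩ := hr
      refine (algebraMap_smul _ _ _).trans ((LocalizedModule.smul'_mk r _ s).trans ?_)
      rw [show r • (LinearMap.ker f).subtype m = 0 from h r hr _ m.2, LocalizedModule.zero_mk]
    | zero => exact zero_smul _ _
    | add x y _ _ hx hy => rw [add_smul, hx, hy, add_zero]
    | smul c x _ hx => rw [smul_assoc, hx, smul_zero]

section
variable {R : Type u} [CommRing R]

/-- The module `T'` is the localization of `T` at `p`. So the property passes from `T` to `T'`, and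
conversely it makes some `b ^ t • T` vanish at each prime strictly below `p`. -/
lemma HomColimit.isEventuallyArtinian_localization [IsNoetherianRing R] {a b : Ideal R}
    {N T : Type u} [AddCommGroup N] [Module R N] [AddCommGroup T] [Module R T]
    (H : HomColimit a N T) (p : Ideal R) [p.IsPrime] {T' : Type u} [AddCommGroup T']
    [Module (Localization.AtPrime p) T']
    (H' : HomColimit (a.map (algebraMap R (Localization.AtPrime p)))
      (LocalizedModule p.primeCompl N) T') :
    (IsEventuallyArtinian b T →
      IsEventuallyArtinian (b.map (algebraMap R (Localization.AtPrime p))) T') ∧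
    (IsEventuallyArtinian (b.map (algebraMap R (Localization.AtPrime p))) T' →
      ∀ q : Ideal R, q.IsPrime → q < p →
        ∃ t : ℕ, ∀ z ∈ (b ^ t • ⊤ : Submodule R T), ∃ s ∉ q, s • z = 0) := by
  let _ : Module R T' := Module.compHom T' (algebraMap R (Localization.AtPrime p))
  have : IsScalarTower R (Localization.AtPrime p) T' :=
    ⟨fun r x t => by rw [Algebra.smul_def, mul_smul]; rfl⟩
  obtain ⟨g, hg⟩ := H.exists_isLocalizedModule p.primeCompl (Localization.AtPrime p)
    (H'.restrictScalars p.primeCompl (Localization.AtPrime p))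
    (LocalizedModule.mkLinearMap p.primeCompl N)
  exact ⟨fun h => h.of_isLocalizedModule p.primeCompl (Localization.AtPrime p) g,
    fun h q hq hqp => exists_smul_eq_zero_of_isLocalizedModule hq hqp g h⟩

/-- The first and the second local cohomology modules of `M` both become Artinian after
multiplication by some power of `b`. -/
def IsEventuallyArtinianUpToTwo (a b : Ideal R) (M : Type u) [AddCommGroup M] [Module R M] :
    Prop :=
  IsEventuallyArtinian b (LocalCohomologyModule a 1 M) ∧
    IsEventuallyArtinian b (LocalCohomologyModule a 2 M)

lemma isEventuallyArtinianUpToTwo_iff_of_surjective [IsNoetherianRing R] {a b : Ideal R}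
    {M N : Type u} [AddCommGroup M] [Module R M] [AddCommGroup N] [Module R N]
    (f : M →ₗ[R] N) (hf : Function.Surjective f) (k : ℕ)
    (hk : ∀ r ∈ b ^ k, ∀ z, f z = 0 → r • z = 0) :
    IsEventuallyArtinianUpToTwo a b M ↔ IsEventuallyArtinianUpToTwo a b N := by
  obtain ⟨E₁⟩ := nonempty_extColimit a M 0
  obtain ⟨E₂⟩ := nonempty_extColimit a M 1
  obtain ⟨E₁'⟩ := nonempty_extColimit a N 0
  obtain ⟨E₂'⟩ := nonempty_extColimit a N 1
  exact and_congr (E₁.isEventuallyArtinian_iff E₁' f hf k hk)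
    (E₂.isEventuallyArtinian_iff E₂' f hf k hk)

lemma two_lt_minimaxnessDim_iff [IsNoetherianRing R] {a b : Ideal R} (hba : b ≤ a)
    (M : Type u) [AddCommGroup M] [Module R M] :
    2 < minimaxnessDim b a M ↔ IsEventuallyArtinianUpToTwo a b M := by
  have key : ∀ i, (∃ t : ℕ, 0 < t ∧ IsMinimaxModule R
      (b ^ t • ⊤ : Submodule R (LocalCohomologyModule a (i + 1) M))) ↔
      IsEventuallyArtinian b (LocalCohomologyModule a (i + 1) M) := fun i => by
    obtain ⟨E⟩ := nonempty_extColimit a M i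
    exact exists_isMinimaxModule_iff hba E.exists_pow_smul_eq_zero
  rw [IsEventuallyArtinianUpToTwo, ← key 0, ← key 1, ← ENat.add_one_le_iff (by simp),
    minimaxnessDim, le_sInf_iff]
  constructor
  · intro h
    constructor
    all_goals
      by_contra! hn
      have := h _ ⟨_, by omega, rfl, hn⟩
      norm_cast at this
  · rintro ⟨h1, h2⟩ _ ⟨i, hi, rfl, hn⟩
    obtain ⟨t, ht, h1⟩ := h1
    obtain ⟨s, hs, h2⟩ := h2
    have hi1 : i ≠ 1 := by rintro rfl; exact hn t ht h1
    have hi2 : i ≠ 2 := by rintro rfl; exact hn s hs h2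
    have : 3 ≤ i := by omega
    exact_mod_cast this

/-- The local-global principle for a module `N` without nonzero elements killed by `b`. With
`y ∈ b` regular on `N`, the second local cohomology of `N` is the first one of `C = N_y ⧸ N`, over
`R` as well as after localizing, so that only limits of `Hom`-modules have to be compared. -/
theorem isEventuallyArtinianUpToTwo_iff_forall_localization_of_torsionFree [IsNoetherianRing R]
    {a b : Ideal R} (hba : b ≤ a) (N : Type u) [AddCommGroup N] [Module R N] [Module.Finite R N]
    (hN : ∀ d : N, (∀ r ∈ b, r • d = 0) → d = 0) :
    (∀ (p : Ideal R) [p.IsPrime], IsEventuallyArtinianUpToTwo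
      (a.map (algebraMap R (Localization.AtPrime p)))
      (b.map (algebraMap R (Localization.AtPrime p))) (LocalizedModule p.primeCompl N)) ↔
      IsEventuallyArtinianUpToTwo a b N := by
  obtain ⟨y, hyb, hyN⟩ := exists_mem_isSMulRegular b hN
  have hya := hba hyb
  let ι := LocalizedModule.mkLinearMap (Submonoid.powers y) N
  let π := (LinearMap.range ι).mkQ
  have hι : Function.Injective ι := by
    refine (IsLocalizedModule.injective_iff_isRegular (Submonoid.powers y) ι).2 ?_
    rintro ⟨_, n, rfl⟩
    exact hyN.pow n
  have hπ : Function.Surjective π := Submodule.mkQ_surjective _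
  have hex : Function.Exact ι π := LinearMap.exact_map_mkQ_range ι
  have hy : Function.Bijective fun x : LocalizedModule (Submonoid.powers y) N => y • x :=
    (Module.End.isUnit_iff _).1
      (IsLocalizedModule.map_units ι (⟨y, Submonoid.mem_powers y⟩ : Submonoid.powers y))
  obtain ⟨E₁⟩ := nonempty_extColimit a N 0
  obtain ⟨E₂⟩ := nonempty_extColimit a N 1
  let H₁ := E₁.toHomColimit
  let H₂ := (E₂.ofExact hex hι hπ hya hy).toHomColimit
  have loc₁ : ∀ (p : Ideal R) [p.IsPrime], Nonempty (HomColimit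
      (a.map (algebraMap R (Localization.AtPrime p))) (LocalizedModule p.primeCompl N)
      (LocalCohomologyModule (a.map (algebraMap R (Localization.AtPrime p))) 1
        (LocalizedModule p.primeCompl N))) := fun p _ => by
    obtain ⟨E⟩ := nonempty_extColimit (a.map (algebraMap R (Localization.AtPrime p)))
      (LocalizedModule p.primeCompl N) 0
    exact ⟨E.toHomColimit⟩
  have loc₂ : ∀ (p : Ideal R) [p.IsPrime], Nonempty (HomColimit
      (a.map (algebraMap R (Localization.AtPrime p))) (LocalizedModule p.primeCompl
        (LocalizedModule (Submonoid.powers y) N ⧸ LinearMap.range ι))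
      (LocalCohomologyModule (a.map (algebraMap R (Localization.AtPrime p))) 2
        (LocalizedModule p.primeCompl N))) := fun p _ => by
    obtain ⟨E⟩ := nonempty_extColimit (a.map (algebraMap R (Localization.AtPrime p)))
      (LocalizedModule p.primeCompl N) 1
    exact ⟨(E.ofExact (ι := LocalizedModule.map p.primeCompl ι)
      (π := LocalizedModule.map p.primeCompl π) (LocalizedModule.map_exact p.primeCompl ι π hex)
      (LocalizedModule.map_injective p.primeCompl ι hι)
      (LocalizedModule.map_surjective p.primeCompl π hπ)
      (Ideal.mem_map_of_mem _ hya) (bijective_smul_localizedModule p.primeCompl hy)).toHomColimit⟩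
  constructor
  · intro h
    have hV₁ : VanishesAwayFromMax b (LocalCohomologyModule a 1 N) := fun q hq hqm => by
      -- Vanishing at `q` comes from the hypothesis at a maximal ideal strictly above `q`.
      obtain ⟨p, hp, hqp⟩ := Ideal.exists_le_maximal q hq.ne_top
      obtain ⟨H'⟩ := loc₁ p
      exact (H₁.isEventuallyArtinian_localization p H').2 (h p).1 q hq
        (lt_of_le_of_ne hqp fun h => hqm (h ▸ hp))
    have hV₂ : VanishesAwayFromMax b (LocalCohomologyModule a 2 N) := fun q hq hqm => by
      obtain ⟨p, hp, hqp⟩ := Ideal.exists_le_maximal q hq.ne_top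
      obtain ⟨H'⟩ := loc₂ p
      exact (H₂.isEventuallyArtinian_localization p H').2 (h p).2 q hq
        (lt_of_le_of_ne hqp fun h => hqm (h ▸ hp))
    have h₁ : IsEventuallyArtinian b (LocalCohomologyModule a 1 N) :=
      hV₁.isEventuallyArtinian E₁.exists_pow_smul_eq_zero
        (E₁.isMinimaxModule_torsionBySet (fun d hd => hN d fun r hr => hd r (hba hr))
          IsMinimaxModule.of_finite)
    refine ⟨h₁, hV₂.isEventuallyArtinian E₂.exists_pow_smul_eq_zero ?_⟩
    exact isMinimaxModule_torsionBySet_two hex hι hπ hya hy E₂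
      (isMinimaxModule_idealPowTorsion hex hι hπ hya hy E₁ hyb h₁)
  · rintro ⟨h₁, h₂⟩ p hp
    obtain ⟨H₁'⟩ := loc₁ p
    obtain ⟨H₂'⟩ := loc₂ p
    exact ⟨(H₁.isEventuallyArtinian_localization p H₁').1 h₁,
      (H₂.isEventuallyArtinian_localization p H₂').1 h₂⟩
end

theorem theorem2p12 (R : Type u) [CommRing R] [IsNoetherianRing R] (a b : Ideal R) (hba : b ≤ a)
    (M : Type u) [AddCommGroup M] [Module R M] [Module.Finite R M] :
    (∀ (p : Ideal R) [p.IsPrime],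
        2 < minimaxnessDim (b.map (algebraMap R (Localization.AtPrime p)))
          (a.map (algebraMap R (Localization.AtPrime p)))
          (LocalizedModule p.primeCompl M)) ↔
      2 < minimaxnessDim b a M := by
  let f := (idealPowTorsion b M).mkQ
  have hf : Function.Surjective f := Submodule.mkQ_surjective _
  obtain ⟨k, hk⟩ : ∃ k : ℕ, ∀ r ∈ b ^ k, ∀ z, f z = 0 → r • z = 0 := by
    obtain ⟨k, hk⟩ := exists_pow_smul_eq_zero_of_le_idealPowTorsion (idealPowTorsion b M)
      (IsNoetherian.noetherian _) le_rfl
    exact ⟨k, fun r hr z hz => hk r hr z ((Submodule.Quotient.mk_eq_zero _).1 hz)⟩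
  rw [two_lt_minimaxnessDim_iff hba, isEventuallyArtinianUpToTwo_iff_of_surjective f hf k hk,
    ← isEventuallyArtinianUpToTwo_iff_forall_localization_of_torsionFree hba _
      eq_zero_of_smul_quotient_idealPowTorsion]
  refine forall_congr' fun p => forall_congr' fun hp => ?_
  rw [two_lt_minimaxnessDim_iff (Ideal.map_mono hba)]
  refine isEventuallyArtinianUpToTwo_iff_of_surjective (LocalizedModule.map p.primeCompl f)
    (LocalizedModule.map_surjective p.primeCompl f hf) k ?_
  rw [← Ideal.map_pow]
  exact smul_eq_zero_of_localizedModule_map_eq_zero p.primeCompl f (b ^ k) hk
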